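/- Let $M\ge 1$, let $1>\rho_1>\dots>\rho_M>0$ and $\beta>2\rho_1$ be real, put $\rho'=(\rho_1,\rho_1-\rho_2,\dots,\rho_1-\rho_M)$, and let $$E_{\rho',\beta}(z_1,\dots,z_M)=\sum_{k=0}^\infty\ \sum_{k_1+\dots+k_M=k}\binom{k}{k_1,\dots,k_M}\frac{\prod_{j=1}^M z_j^{k_j}}{\Gamma\bigl(\beta+\rho_1k_1+\sum_{j=2}^M(\rho_1-\rho_j)k_j\bigr)}$$ be the multinomial Mittag-Leffler function. For $R>0$ and $\rho_1\pi/2<\theta<\rho_1\pi$ let $\gamma(R,\theta)$ be the contour from $\infty e^{-i\theta}$ to $\infty e^{i\theta}$ that consists of the rays $|s|>R$, $\arg s=\pm\theta$ and the arc $|s|=R$, $|\arg s|\le\theta$. For $k\ge 3$ and $z_2,\dots,z_M<0$ put $$C_k(z_2,\dots,z_M)=\frac{1}{2\rho_1\pi i}\int_{\gamma(R,\theta)}\exp\bigl(s^{1/\rho_1}\bigr)\,s^{(1-\beta)/\rho_1}\Bigl(s-\sum_{j=2}^M z_js^{\rho_j/\rho_1}\Bigr)^{k-1}ds$$ (principal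 branches of the powers). The value $C_k(z_2,\dots,z_M)$ does not depend on the choice of $R$ and $\theta$; it depends only on $k$, $z_2,\dots,z_M$, $\rho_1,\dots,\rho_M$ and $\beta$. Let $\rho_1\pi/2<\mu<\rho_1\pi$, $K>0$, and let $p$ be a positive integer. Then, as $|z_1|\to\infty$ in the sector $\mu\le|\arg z_1|\le\pi$, uniformly in $-K\le z_j<0$ $(j=2,\dots,M)$, $$E_{\rho',\beta}(z_1,\dots,z_M)=-\frac{1}{z_1}\frac{1}{\Gamma(\beta-\rho_1)}-\frac{1}{z_1^2}\left(\frac{1}{\Gamma(\beta-2\rho_1)}-\sum_{j=2}^M\frac{z_j}{\Gamma(\beta-\rho_1-\rho_j)}\right)-\sum_{k=3}^p\frac{C_k(z_2,\dots,z_M)}{z_1^k}+O\bigl(|z_1|^{-p-1}\bigr),$$ where the sum over $k$ is empty for $p\le 2$, and the constant in $O$ depends only on $\rho_1,\dots,\rho_M,\beta,\mu,K,p$. -/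

import Mathlib

open scoped BigOperators

noncomputable section

/-- The multinomial Mittag-Leffler function `E_{(b_j), β}((z_j))`: the sum over `k` of the sums over
all multi-indices `m` with `∑ j, m j = k`. -/
def multinomialMittagLeffler {ι : Type*} [Fintype ι] [DecidableEq ι]
    (b : ι → ℝ) (β : ℝ) (z : ι → ℂ) : ℂ :=
  ∑' k : ℕ, ∑ m ∈ Finset.piAntidiag (Finset.univ : Finset ι) k,
    (Nat.multinomial Finset.univ m : ℂ) * (∏ j, z j ^ m j) /
      (Real.Gamma (β + ∑ j, b j * (m j : ℝ)) : ℂ)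

/-- The exponent vector `(ρ₁, ρ₁ - ρ₂, …, ρ₁ - ρ_M)`, where `M = n + 1` and `ρ₁ = ρ 0`. -/
def rhoPrime {n : ℕ} (ρ : Fin (n + 1) → ℝ) : Fin (n + 1) → ℝ :=
  Fin.cons (ρ 0) (fun j : Fin n => ρ 0 - ρ j.succ)

/-- The contour integral of `f` over `γ(R, θ)`, which consists of the two rays
`|s| > R, arg s = ± θ` and the arc `|s| = R, |arg s| ≤ θ`, and runs
from `∞ * exp (-iθ)` to `∞ * exp (iθ)`. -/
def hankelIntegral (R θ : ℝ) (f : ℂ → ℂ) : ℂ :=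
  (∫ r in Set.Ioi R, f (r * Complex.exp (θ * Complex.I)) * Complex.exp (θ * Complex.I))
    - (∫ r in Set.Ioi R, f (r * Complex.exp (-θ * Complex.I)) * Complex.exp (-θ * Complex.I))
    + ∫ φ in (-θ)..θ, f (R * Complex.exp (φ * Complex.I)) *
        (Complex.I * R * Complex.exp (φ * Complex.I))

/-- `Q(z₂, …, z_M, s) = s - ∑_{j ≥ 2} z_j s^{ρ_j/ρ₁}` (principal branch); `w` is `(z₂, …, z_M)`. -/
def mlQ {n : ℕ} (ρ : Fin (n + 1) → ℝ) (w : Fin n → ℝ) (s : ℂ) : ℂ :=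
  s - ∑ j : Fin n, (w j : ℂ) * s ^ ((ρ j.succ / ρ 0 : ℝ) : ℂ)

end

/-! The substitution `s = exp (ρ 0 * v)` turns `γ(R, θ)` into the boundary of a half strip in the
`v`-plane and every branch of a power into an exponential. The kernel `exp (exp v) * exp ((1 - b) *
v)` is entire and decays doubly exponentially where `cos (im v) < 0`, so Cauchy's theorem moves the
contour freely.

Hankel's formula `stripIntegral_hankelKernel` writes each `1 / Γ` of the series as such an integral.
Far to the right the multinomial series is a convergent geometric series under the integral sign.
Its sum gives the integrand `hankelKernel (β - ρ 0) v / (Q - z)`, where `z = z₁` and `Q = expQ ρ w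
v`.

The decisive fact is `abs_arg_expQ_le`: since `z_j < 0`, `Q` is a combination with positive
coefficients of exponentials whose arguments have modulus at most `ρ 0 * φ`, so `Q` stays in that
sector. If `ρ 0 * φ < μ`, then `|Q - z|` is at least a constant times `|z|`
(`exists_mul_norm_le_norm_sub`). There are no poles, so the contour can be fixed independently of
`z` and `w`. Expanding `1 / (Q - z)` in powers of `Q / z` with its exact remainder gives the
coefficients, and the lower bound makes the remainder uniform. The coefficients with `k = 1, 2` are
again Hankel integrals. -/

namespace MultinomialMittagLeffler

open Complex Filter MeasureTheory Set Topology

/-! ### Contour integrals over the boundary of a half strip -/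

section

/-- The half strip of the points with `a ≤ re v` and `|im v| ≤ φ`. -/
def halfStrip (a φ : ℝ) : Set ℂ := {v | a ≤ v.re ∧ |v.im| ≤ φ}

/-- The integral of `g` over the boundary of `halfStrip a φ`, from `∞ - iφ` to `∞ + iφ`. -/
noncomputable def stripIntegral (a φ : ℝ) (g : ℂ → ℂ) : ℂ :=
  (∫ x in Ioi a, g (x + φ * I)) - (∫ x in Ioi a, g (x + (-φ : ℝ) * I))
    + I * ∫ y in (-φ)..φ, g (a + y * I)

/-- The modulus of `exp (exp v)` times `exp (c * |re v|)`. -/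
noncomputable def stripWeight (c : ℝ) (v : ℂ) : ℝ :=
  Real.exp ((exp v).re + c * |v.re|)

lemma stripWeight_pos (c : ℝ) (v : ℂ) : 0 < stripWeight c v := Real.exp_pos _

lemma continuous_stripWeight (c : ℝ) : Continuous (stripWeight c) := by
  unfold stripWeight
  fun_prop

/-- A function on the half strip that is continuous there and grows at most like `stripWeight`. -/
structure StripBound (a φ : ℝ) (A c : ℝ) (g : ℂ → ℂ) : Prop where
  continuousOn : ContinuousOn g (halfStrip a φ)
  norm_le : ∀ v ∈ halfStrip a φ, ‖g v‖ ≤ A * stripWeight c v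

/-- The factor `exp (-δ * exp x)` beats every `exp (c * |x|)`. The rate `exp (-x)` suffices both for
integrability on rays and for discarding vertical pieces at infinity. -/
lemma exists_weight_le (a c δ : ℝ) (hδ : 0 < δ) :
    ∃ B : ℝ, 0 < B ∧ ∀ x y : ℝ, a ≤ x → Real.cos y ≤ -δ →
      stripWeight c (x + y * I) ≤ B * Real.exp (-x) := by
  obtain ⟨k, hk⟩ := exists_nat_ge (|c| + 1)
  refine ⟨k.factorial / δ ^ k * Real.exp (2 * (k * |a|)), by positivity, fun x y hx hy => ?_⟩
  have h1 : stripWeight c (x + y * I) = Real.exp (Real.exp x * Real.cos y + c * |x|) := by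
    simp [stripWeight, exp_re]
  have h2 : Real.exp (Real.exp x * Real.cos y + c * |x|)
      ≤ Real.exp (-(δ * Real.exp x)) * Real.exp (|c| * |x|) := by
    rw [← Real.exp_add]
    apply Real.exp_le_exp.2
    have := mul_le_mul_of_nonneg_left hy (Real.exp_pos x).le
    have := mul_le_mul_of_nonneg_right (le_abs_self c) (abs_nonneg x)
    linarith
  have h3 : Real.exp (-(δ * Real.exp x)) ≤ k.factorial / δ ^ k * Real.exp (-(k * x)) := by
    have h := Real.pow_div_factorial_le_exp (δ * Real.exp x) (by positivity) k
    rw [mul_pow, ← Real.exp_nat_mul] at h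
    rw [Real.exp_neg, Real.exp_neg]
    calc (Real.exp (δ * Real.exp x))⁻¹ ≤ (δ ^ k * Real.exp (k * x) / k.factorial)⁻¹ :=
          inv_anti₀ (by positivity) h
      _ = _ := by field_simp
  have h4 : Real.exp (-(k * x)) * Real.exp (|c| * |x|)
      ≤ Real.exp (2 * (k * |a|)) * Real.exp (-x) := by
    rw [← Real.exp_add, ← Real.exp_add]
    apply Real.exp_le_exp.2
    -- The left end `a` may be negative; on `x ≥ a` replacing `|x|` by `x` costs only a constant.
    have h5 : |x| ≤ x + 2 * |a| := by
      rcases abs_cases x with h | h <;> rcases abs_cases a with h' | h' <;> linarith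
    have h6 : (|c| + 1) * |x| ≤ k * |x| := mul_le_mul_of_nonneg_right hk (abs_nonneg x)
    have h7 := mul_le_mul_of_nonneg_left h5 (Nat.cast_nonneg (α := ℝ) k)
    have h8 := le_abs_self x
    have h9 := neg_abs_le x
    nlinarith
  rw [h1]
  calc _ ≤ _ := h2
    _ ≤ k.factorial / δ ^ k * Real.exp (-(k * x)) * Real.exp (|c| * |x|) := by gcongr
    _ = k.factorial / δ ^ k * (Real.exp (-(k * x)) * Real.exp (|c| * |x|)) := by ring
    _ ≤ k.factorial / δ ^ k * (Real.exp (2 * (k * |a|)) * Real.exp (-x)) := by gcongr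
    _ = _ := by ring

lemma cos_neg_of_mem {y : ℝ} (h1 : Real.pi / 2 < y) (h2 : y < 3 * Real.pi / 2) :
    Real.cos y < 0 :=
  Real.cos_neg_of_pi_div_two_lt_of_lt h1 (by linarith)

lemma integrableOn_weight_ray (a c : ℝ) {y : ℝ} (hy : Real.cos y < 0) :
    IntegrableOn (fun x : ℝ => stripWeight c (x + y * I)) (Ioi a) := by
  obtain ⟨B, -, hB⟩ := exists_weight_le a c (-Real.cos y) (by linarith)
  refine Integrable.mono' ((integrableOn_exp_neg_Ioi a).const_mul B) ?_ ?_
  · exact ((continuous_stripWeight c).comp (by fun_prop)).aestronglyMeasurable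
  · filter_upwards [ae_restrict_mem measurableSet_Ioi] with x hx
    rw [Real.norm_of_nonneg (stripWeight_pos _ _).le]
    exact hB x y (le_of_lt hx) (by linarith)

lemma ray_mem {a φ x y : ℝ} (hx : a ≤ x) (hy : |y| ≤ φ) : (x + y * I : ℂ) ∈ halfStrip a φ := by
  simp [halfStrip, hx, hy]

namespace StripBound

variable {a φ A c : ℝ} {g : ℂ → ℂ}

lemma integrableOn_ray (hg : StripBound a φ A c g) {y : ℝ} (hy : |y| ≤ φ)
    (hc : Real.cos y < 0) : IntegrableOn (fun x : ℝ => g (x + y * I)) (Ioi a) := by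
  refine Integrable.mono' ((integrableOn_weight_ray a c hc).const_mul A) ?_ ?_
  · refine ContinuousOn.aestronglyMeasurable ?_ measurableSet_Ioi
    exact hg.continuousOn.comp (by fun_prop) fun x hx => ray_mem (le_of_lt hx) hy
  · filter_upwards [ae_restrict_mem measurableSet_Ioi] with x hx
    exact hg.norm_le _ (ray_mem (le_of_lt hx) hy)

lemma intervalIntegrable (hg : StripBound a φ A c g) {x : ℝ} (hx : a ≤ x) (hφ : 0 ≤ φ) :
    IntervalIntegrable (fun y : ℝ => g (x + y * I)) volume (-φ) φ := by
  refine ContinuousOn.intervalIntegrable ?_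
  rw [uIcc_of_le (by linarith)]
  exact hg.continuousOn.comp (by fun_prop) fun y hy => ray_mem hx (abs_le.2 hy)

lemma mono (hg : StripBound a φ A c g) {a' φ' : ℝ} (ha : a ≤ a') (hφ : φ' ≤ φ) :
    StripBound a' φ' A c g := by
  have : halfStrip a' φ' ⊆ halfStrip a φ := fun v hv => ⟨ha.trans hv.1, hv.2.trans hφ⟩
  exact ⟨hg.continuousOn.mono this, fun v hv => hg.norm_le v (this hv)⟩

lemma nonneg (hg : StripBound a φ A c g) (hφ : 0 ≤ φ) : 0 ≤ A :=
  nonneg_of_mul_nonneg_left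
    ((norm_nonneg _).trans (hg.norm_le _ (ray_mem (le_refl a) (abs_of_nonneg hφ).le)))
    (stripWeight_pos _ _)

lemma mono_weight (hg : StripBound a φ A c g) {c' : ℝ} (hφ : 0 ≤ φ) (hc : c ≤ c') :
    StripBound a φ A c' g := by
  refine ⟨hg.continuousOn, fun v hv => (hg.norm_le v hv).trans ?_⟩
  refine mul_le_mul_of_nonneg_left (Real.exp_le_exp.2 ?_) (hg.nonneg hφ)
  linarith [mul_le_mul_of_nonneg_right hc (abs_nonneg v.re)]

lemma sum {ι : Type*} {s : Finset ι} {A : ι → ℝ} {F : ι → ℂ → ℂ}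
    (hF : ∀ i ∈ s, StripBound a φ (A i) c (F i)) :
    StripBound a φ (∑ i ∈ s, A i) c (fun v => ∑ i ∈ s, F i v) := by
  refine ⟨continuousOn_finsetSum s fun i hi => (hF i hi).continuousOn, fun v hv => ?_⟩
  rw [Finset.sum_mul]
  exact norm_sum_le_of_le _ fun i hi => (hF i hi).norm_le v hv

lemma const_mul (hg : StripBound a φ A c g) (k : ℂ) :
    StripBound a φ (‖k‖ * A) c (fun v => k * g v) := by
  refine ⟨hg.continuousOn.const_mul k, fun v hv => ?_⟩
  rw [norm_mul, mul_assoc]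
  exact mul_le_mul_of_nonneg_left (hg.norm_le v hv) (norm_nonneg k)

end StripBound

/-- The integral of `stripWeight c` with respect to arc length over the boundary of the half
strip. -/
noncomputable def weightIntegral (a φ c : ℝ) : ℝ :=
  (∫ x in Ioi a, stripWeight c ((x : ℝ) + (φ : ℝ) * I))
    + (∫ x in Ioi a, stripWeight c ((x : ℝ) + (-φ : ℝ) * I))
    + ∫ y in (-φ)..φ, stripWeight c ((a : ℝ) + (y : ℝ) * I)

variable {a φ A c A' c' : ℝ} {f g : ℂ → ℂ}

lemma stripIntegral_congr (hφ : 0 ≤ φ) (h : ∀ v ∈ halfStrip a φ, f v = g v) :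
    stripIntegral a φ f = stripIntegral a φ g := by
  unfold stripIntegral
  congr 1
  · congr 1
    · exact setIntegral_congr_fun measurableSet_Ioi fun x hx =>
        h _ (ray_mem (le_of_lt hx) (abs_of_nonneg hφ).le)
    · exact setIntegral_congr_fun measurableSet_Ioi fun x hx =>
        h _ (ray_mem (le_of_lt hx) (by rw [abs_neg, abs_of_nonneg hφ]))
  · congr 1
    refine intervalIntegral.integral_congr fun y hy => h _ (ray_mem le_rfl ?_)
    rw [uIcc_of_le (by linarith)] at hy
    exact abs_le.2 hy

lemma norm_stripIntegral_le (hφ : 0 ≤ φ) (hc : Real.cos φ < 0)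
    (h : ∀ v ∈ halfStrip a φ, ‖g v‖ ≤ A * stripWeight c v) :
    ‖stripIntegral a φ g‖ ≤ A * weightIntegral a φ c := by
  have hc' : Real.cos (-φ) < 0 := by rwa [Real.cos_neg]
  have h1 : ‖∫ x in Ioi a, g ((x : ℝ) + (φ : ℝ) * I)‖
      ≤ ∫ x in Ioi a, A * stripWeight c ((x : ℝ) + (φ : ℝ) * I) := by
    refine norm_integral_le_of_norm_le ((integrableOn_weight_ray a c hc).const_mul A) ?_
    filter_upwards [ae_restrict_mem measurableSet_Ioi] with x hx
    exact h _ (ray_mem (le_of_lt hx) (abs_of_nonneg hφ).le)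
  have h2 : ‖∫ x in Ioi a, g ((x : ℝ) + (-φ : ℝ) * I)‖
      ≤ ∫ x in Ioi a, A * stripWeight c ((x : ℝ) + (-φ : ℝ) * I) := by
    refine norm_integral_le_of_norm_le ((integrableOn_weight_ray a c hc').const_mul A) ?_
    filter_upwards [ae_restrict_mem measurableSet_Ioi] with x hx
    exact h _ (ray_mem (le_of_lt hx) (by rw [abs_neg, abs_of_nonneg hφ]))
  have h3 : ‖∫ y in (-φ)..φ, g ((a : ℝ) + (y : ℝ) * I)‖
      ≤ ∫ y in (-φ)..φ, A * stripWeight c ((a : ℝ) + (y : ℝ) * I) := by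
    refine intervalIntegral.norm_integral_le_of_norm_le (by linarith) ?_ ?_
    · refine Eventually.of_forall fun y hy => h _ (ray_mem le_rfl (abs_le.2 ⟨hy.1.le, hy.2⟩))
    · refine Continuous.intervalIntegrable ?_ _ _
      exact continuous_const.mul ((continuous_stripWeight c).comp (by fun_prop))
  rw [integral_const_mul] at h1 h2
  rw [intervalIntegral.integral_const_mul] at h3
  calc ‖stripIntegral a φ g‖ ≤ _ := norm_add_le _ _
    _ ≤ _ := add_le_add (norm_sub_le _ _) (by rw [norm_mul, norm_I, one_mul])
    _ ≤ _ := add_le_add (add_le_add h1 h2) h3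
    _ = _ := by rw [weightIntegral]; ring

lemma stripIntegral_const_mul (k : ℂ) :
    stripIntegral a φ (fun v => k * g v) = k * stripIntegral a φ g := by
  unfold stripIntegral
  rw [integral_const_mul, integral_const_mul, intervalIntegral.integral_const_mul]
  ring

lemma stripIntegral_add (hφ : 0 ≤ φ) (hc : Real.cos φ < 0)
    (hf : StripBound a φ A c f) (hg : StripBound a φ A' c' g) :
    stripIntegral a φ (fun v => f v + g v) = stripIntegral a φ f + stripIntegral a φ g := by
  have hc' : Real.cos (-φ) < 0 := by rwa [Real.cos_neg]
  have e1 : |φ| ≤ φ := (abs_of_nonneg hφ).le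
  have e2 : |-φ| ≤ φ := by rwa [abs_neg]
  unfold stripIntegral
  rw [integral_add (hf.integrableOn_ray e1 hc) (hg.integrableOn_ray e1 hc),
    integral_add (hf.integrableOn_ray e2 hc') (hg.integrableOn_ray e2 hc'),
    intervalIntegral.integral_add (hf.intervalIntegrable le_rfl hφ)
      (hg.intervalIntegrable le_rfl hφ)]
  ring

lemma stripIntegral_sum {ι : Type*} (s : Finset ι) {F : ι → ℂ → ℂ} (hφ : 0 ≤ φ)
    (hc : Real.cos φ < 0) (hF : ∀ i ∈ s, ∃ A c, StripBound a φ A c (F i)) :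
    stripIntegral a φ (fun v => ∑ i ∈ s, F i v) = ∑ i ∈ s, stripIntegral a φ (F i) := by
  have hc' : Real.cos (-φ) < 0 := by rwa [Real.cos_neg]
  have e1 : |φ| ≤ φ := (abs_of_nonneg hφ).le
  have e2 : |-φ| ≤ φ := by rwa [abs_neg]
  choose! A c hF using hF
  unfold stripIntegral
  rw [integral_finsetSum _ fun i hi => (hF i hi).integrableOn_ray e1 hc,
    integral_finsetSum _ fun i hi => (hF i hi).integrableOn_ray e2 hc',
    intervalIntegral.integral_finsetSum fun i hi => (hF i hi).intervalIntegrable le_rfl hφ,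
    Finset.sum_add_distrib, Finset.sum_sub_distrib, Finset.mul_sum]

/-- By Cauchy's theorem, the integral over the boundary of a half strip is the limit of integrals
over vertical segments. -/
lemma tendsto_vertical (hφ : 0 ≤ φ) (hc : Real.cos φ < 0) (hg : StripBound a φ A c g)
    (hd : DifferentiableOn ℂ g (halfStrip a φ)) :
    Tendsto (fun T : ℝ => I * ∫ y in (-φ)..φ, g (T + y * I)) atTop
      (𝓝 (stripIntegral a φ g)) := by
  have hc' : Real.cos (-φ) < 0 := by rwa [Real.cos_neg]
  have e1 : |φ| ≤ φ := (abs_of_nonneg hφ).le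
  have e2 : |-φ| ≤ φ := by rwa [abs_neg]
  have l1 := intervalIntegral_tendsto_integral_Ioi a (hg.integrableOn_ray e1 hc) tendsto_id
  have l2 := intervalIntegral_tendsto_integral_Ioi a (hg.integrableOn_ray e2 hc') tendsto_id
  refine ((l1.sub l2).add_const (I * ∫ y in (-φ)..φ, g (a + y * I))).congr' ?_
  filter_upwards [eventually_ge_atTop a] with T hT
  have h := integral_boundary_rect_eq_zero_of_differentiableOn g (a + (-φ : ℝ) * I)
    (T + (φ : ℝ) * I) (hd.mono fun v hv => by
      obtain ⟨h1, h2⟩ := hv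
      simp only [mem_preimage, add_re, ofReal_re, mul_re, I_re, mul_zero, ofReal_im, I_im, mul_one,
        sub_self, add_zero, add_im, mul_im, zero_add] at h1 h2
      rw [uIcc_of_le hT] at h1
      rw [uIcc_of_le (by linarith)] at h2
      exact ⟨h1.1, abs_le.2 h2⟩)
  simp only [add_re, ofReal_re, mul_re, I_re, mul_zero, ofReal_im, I_im, mul_one,
        sub_self, add_zero, add_im, mul_im, zero_add, smul_eq_mul] at h
  simp only [id]
  linear_combination -h

/-- Both sides are limits of the same integrals over vertical segments. -/
lemma stripIntegral_eq_of_le {b : ℝ} (hab : a ≤ b) (hφ : 0 ≤ φ) (hc : Real.cos φ < 0)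
    (hg : StripBound a φ A c g) (hd : DifferentiableOn ℂ g (halfStrip a φ)) :
    stripIntegral a φ g = stripIntegral b φ g := by
  refine tendsto_nhds_unique (tendsto_vertical hφ hc hg hd)
    (tendsto_vertical hφ hc (hg.mono hab le_rfl) (hd.mono fun v hv => ⟨hab.trans hv.1, hv.2⟩))

/-- The vertical segments for the two heights differ by pieces with `φ ≤ |im v| ≤ ψ`. There the
cosine is bounded away from zero by compactness, so these pieces are `O(exp (-T))`. -/
lemma stripIntegral_angle_eq_of_le {ψ : ℝ} (hφψ : φ ≤ ψ) (h1 : Real.pi / 2 < φ)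
    (h2 : ψ < 3 * Real.pi / 2) (hg : StripBound a ψ A c g)
    (hd : DifferentiableOn ℂ g (halfStrip a ψ)) :
    stripIntegral a φ g = stripIntegral a ψ g := by
  have hπ := Real.pi_pos
  have hφ0 : 0 ≤ φ := by linarith
  have hψ0 : 0 ≤ ψ := by linarith
  have t1 := tendsto_vertical hφ0 (cos_neg_of_mem h1 (by linarith)) (hg.mono le_rfl hφψ)
    (hd.mono fun v hv => ⟨hv.1, hv.2.trans hφψ⟩)
  have t2 := tendsto_vertical hψ0 (cos_neg_of_mem (by linarith) h2) hg hd
  obtain ⟨δ, hδ, hcos⟩ : ∃ δ > 0, ∀ y, φ ≤ y → y ≤ ψ → Real.cos y ≤ -δ := by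
    obtain ⟨y, hy, hmax⟩ := isCompact_Icc.exists_isMaxOn (nonempty_Icc.2 hφψ)
      Real.continuous_cos.continuousOn
    refine ⟨-Real.cos y, ?_, fun x hx1 hx2 => by rw [neg_neg]; exact hmax ⟨hx1, hx2⟩⟩
    linarith [cos_neg_of_mem (y := y) (by linarith [hy.1]) (by linarith [hy.2])]
  obtain ⟨B, hB, hw⟩ := exists_weight_le a c δ hδ
  have hA : 0 ≤ A := hg.nonneg hψ0
  have key : ∀ T : ℝ, a ≤ T → ‖(I * ∫ y in (-ψ)..ψ, g (T + y * I))
      - I * ∫ y in (-φ)..φ, g (T + y * I)‖ ≤ 2 * (A * B * (ψ - φ)) * Real.exp (-T) := by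
    intro T hT
    have hi : ∀ p q : ℝ, |p| ≤ ψ → |q| ≤ ψ →
        IntervalIntegrable (fun y : ℝ => g (T + y * I)) volume p q := fun p q hp hq =>
      (hg.intervalIntegrable hT hψ0).mono_set (by
        rw [uIcc_of_le (by linarith : -ψ ≤ ψ)]
        exact uIcc_subset_Icc (abs_le.1 hp) (abs_le.1 hq))
    have e1 : |φ| ≤ ψ := by rw [abs_of_nonneg hφ0]; exact hφψ
    have e2 : |-φ| ≤ ψ := by rwa [abs_neg]
    have e3 : |ψ| ≤ ψ := (abs_of_nonneg hψ0).le
    have e4 : |-ψ| ≤ ψ := by rwa [abs_neg]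
    have hb : ∀ y, φ ≤ |y| → |y| ≤ ψ → ‖g (T + y * I)‖ ≤ A * (B * Real.exp (-T)) :=
      fun y hy1 hy2 => (hg.norm_le _ (ray_mem hT hy2)).trans
        (mul_le_mul_of_nonneg_left (hw T y hT (by rw [← Real.cos_abs]; exact hcos _ hy1 hy2)) hA)
    have b1 : ‖∫ y in φ..ψ, g (T + y * I)‖ ≤ A * (B * Real.exp (-T)) * |ψ - φ| := by
      refine intervalIntegral.norm_integral_le_of_norm_le_const fun y hy => ?_
      rw [uIoc_of_le hφψ] at hy
      have : |y| = y := abs_of_nonneg (hφ0.trans hy.1.le)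
      exact hb y (by rw [this]; exact hy.1.le) (by rw [this]; exact hy.2)
    have b2 : ‖∫ y in (-ψ)..(-φ), g (T + y * I)‖ ≤ A * (B * Real.exp (-T)) * |-φ - -ψ| := by
      refine intervalIntegral.norm_integral_le_of_norm_le_const fun y hy => ?_
      rw [uIoc_of_le (by linarith)] at hy
      have : |y| = -y := abs_of_nonpos (by linarith [hy.2])
      exact hb y (by rw [this]; linarith [hy.2]) (by rw [this]; linarith [hy.1])
    have hs : (∫ y in (-ψ)..ψ, g (T + y * I)) = (∫ y in (-ψ)..(-φ), g (T + y * I))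
        + (∫ y in (-φ)..φ, g (T + y * I)) + ∫ y in φ..ψ, g (T + y * I) := by
      rw [intervalIntegral.integral_add_adjacent_intervals (hi _ _ e4 e2) (hi _ _ e2 e1),
        intervalIntegral.integral_add_adjacent_intervals (hi _ _ e4 e1) (hi _ _ e1 e3)]
    rw [hs, ← mul_sub, norm_mul, norm_I, one_mul]
    have : (∫ y in (-ψ)..(-φ), g (T + y * I)) + (∫ y in (-φ)..φ, g (T + y * I))
        + (∫ y in φ..ψ, g (T + y * I)) - (∫ y in (-φ)..φ, g (T + y * I))
        = (∫ y in (-ψ)..(-φ), g (T + y * I)) + ∫ y in φ..ψ, g (T + y * I) := by ring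
    rw [this]
    refine (norm_add_le _ _).trans ((add_le_add b2 b1).trans_eq ?_)
    rw [show -φ - -ψ = ψ - φ by ring, abs_of_nonneg (by linarith : 0 ≤ ψ - φ)]
    ring
  have t3 : Tendsto (fun T : ℝ => (I * ∫ y in (-ψ)..ψ, g (T + y * I))
      - I * ∫ y in (-φ)..φ, g (T + y * I)) atTop (𝓝 0) := by
    refine squeeze_zero_norm' ((eventually_ge_atTop a).mono key) ?_
    simpa using (Real.tendsto_exp_neg_atTop_nhds_zero).const_mul (2 * (A * B * (ψ - φ)))
  exact (sub_eq_zero.1 (tendsto_nhds_unique (t2.sub t1) t3)).symm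

end

/-! ### Hankel's formula for the reciprocal Gamma function -/

section

/-- The function `exp s * s ^ (-b)` times `ds / dv`, where `s = exp v`. -/
noncomputable def hankelKernel (b : ℝ) (v : ℂ) : ℂ := exp (exp v) * exp ((1 - b : ℝ) * v)

lemma differentiable_hankelKernel (b : ℝ) : Differentiable ℂ (hankelKernel b) := by
  unfold hankelKernel
  fun_prop

lemma norm_hankelKernel (b : ℝ) (v : ℂ) :
    ‖hankelKernel b v‖ = Real.exp ((exp v).re + (1 - b) * v.re) := by
  rw [hankelKernel, norm_mul, norm_exp, norm_exp, ← Real.exp_add, re_ofReal_mul]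

lemma norm_hankelKernel_le (b : ℝ) (v : ℂ) : ‖hankelKernel b v‖ ≤ stripWeight |1 - b| v := by
  rw [norm_hankelKernel, stripWeight]
  apply Real.exp_le_exp.2
  have : (1 - b) * v.re ≤ |1 - b| * |v.re| := by rw [← abs_mul]; exact le_abs_self _
  linarith

lemma stripBound_hankelKernel (a φ b : ℝ) : StripBound a φ 1 |1 - b| (hankelKernel b) :=
  ⟨(differentiable_hankelKernel b).continuous.continuousOn,
    fun v _ => by rw [one_mul]; exact norm_hankelKernel_le b v⟩

lemma stripIntegral_hankelKernel_eq (b : ℝ) {φ : ℝ} (h1 : Real.pi / 2 < φ) (h2 : φ ≤ Real.pi)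
    (a a' : ℝ) : stripIntegral a φ (hankelKernel b) = stripIntegral a' Real.pi (hankelKernel b) := by
  have hπ := Real.pi_pos
  have hc : Real.cos Real.pi < 0 := by simp
  have hd : ∀ s, DifferentiableOn ℂ (hankelKernel b) s :=
    fun s => (differentiable_hankelKernel b).differentiableOn
  rw [stripIntegral_angle_eq_of_le h2 h1 (by linarith) (stripBound_hankelKernel _ _ b) (hd _)]
  rcases le_total a a' with h | h
  · exact stripIntegral_eq_of_le h hπ.le hc (stripBound_hankelKernel _ _ b) (hd _)
  · exact (stripIntegral_eq_of_le h hπ.le hc (stripBound_hankelKernel _ _ b) (hd _)).symm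

/-- Integration by parts: `hankelKernel b - b * hankelKernel (b + 1)` is the derivative of
`hankelKernel (b + 1)`, whose values at the ends of the vertical segments tend to zero. This mirrors
`Γ(b + 1) = b Γ(b)`. -/
lemma stripIntegral_hankelKernel_succ {b : ℝ} {φ : ℝ} (h1 : Real.pi / 2 < φ) (h2 : φ ≤ Real.pi)
    (a : ℝ) :
    stripIntegral a φ (hankelKernel b) = b * stripIntegral a φ (hankelKernel (b + 1)) := by
  have hπ := Real.pi_pos
  have hφ : 0 ≤ φ := by linarith
  have hc : Real.cos φ < 0 := cos_neg_of_mem h1 (by linarith)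
  have hd : ∀ s b, DifferentiableOn ℂ (hankelKernel b) s :=
    fun s b => (differentiable_hankelKernel b).differentiableOn
  have t1 := tendsto_vertical hφ hc (stripBound_hankelKernel a _ b) (hd _ _)
  have t2 := tendsto_vertical hφ hc (stripBound_hankelKernel a _ (b + 1)) (hd _ _)
  have hder : ∀ v, HasDerivAt (hankelKernel (b + 1))
      (hankelKernel b v - b * hankelKernel (b + 1) v) v := by
    intro v
    have e : HasDerivAt (fun v : ℂ => ((1 - (b + 1) : ℝ) : ℂ) * v) ((1 - (b + 1) : ℝ) : ℂ) v := by
      simpa using (hasDerivAt_id v).const_mul ((1 - (b + 1) : ℝ) : ℂ)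
    refine ((hasDerivAt_exp v).cexp.mul e.cexp).congr_deriv ?_
    have : exp ((1 - b : ℝ) * v) = exp v * exp ((1 - (b + 1) : ℝ) * v) := by
      rw [← exp_add]
      congr 1
      push_cast
      ring
    rw [hankelKernel, hankelKernel, this]
    push_cast
    ring
  have hint : ∀ T : ℝ, (I * ∫ y in (-φ)..φ, hankelKernel b (T + y * I))
      - b * (I * ∫ y in (-φ)..φ, hankelKernel (b + 1) (T + y * I))
      = hankelKernel (b + 1) (T + (φ : ℝ) * I) - hankelKernel (b + 1) (T + (-φ : ℝ) * I) := by
    intro T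
    have hcont : ∀ b, Continuous (fun y : ℝ => hankelKernel b (T + y * I)) := fun b =>
      (differentiable_hankelKernel b).continuous.comp (by fun_prop)
    have := intervalIntegral.integral_eq_sub_of_hasDerivAt (a := -φ) (b := φ)
      (f := fun y : ℝ => hankelKernel (b + 1) (T + y * I))
      (f' := fun y : ℝ => (hankelKernel b (T + y * I) - b * hankelKernel (b + 1) (T + y * I)) * I)
      (fun y _ => (hder _).comp_of_eq y
        (((hasDerivAt_id y).ofReal_comp.mul_const I).const_add (T : ℂ) |>.congr_deriv (by simp)) rfl)
      (Continuous.intervalIntegrable (by have := hcont b; have := hcont (b + 1); fun_prop) _ _)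
    rw [← this, intervalIntegral.integral_mul_const, intervalIntegral.integral_sub
      ((hcont b).intervalIntegrable _ _) (((hcont (b + 1)).const_mul _).intervalIntegrable _ _),
      intervalIntegral.integral_const_mul]
    ring
  have t3 : ∀ y : ℝ, Real.cos y < 0 →
      Tendsto (fun T : ℝ => hankelKernel (b + 1) (T + y * I)) atTop (𝓝 0) := by
    intro y hy
    obtain ⟨B, -, hB⟩ := exists_weight_le a |1 - (b + 1)| (-Real.cos y) (by linarith)
    refine squeeze_zero_norm' ((eventually_ge_atTop a).mono fun T hT =>
      (norm_hankelKernel_le _ _).trans (hB T y hT (by linarith))) ?_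
    simpa using (Real.tendsto_exp_neg_atTop_nhds_zero).const_mul B
  have t4 := (t1.sub (t2.const_mul (b : ℂ))).congr hint
  have t5 := (t3 φ hc).sub (t3 (-φ) (by rwa [Real.cos_neg]))
  rw [sub_zero] at t5
  exact sub_eq_zero.1 (tendsto_nhds_unique t4 t5)

lemma tendsto_segment_one : Tendsto
    (fun a : ℝ => I * ∫ y in (-Real.pi)..Real.pi, hankelKernel 1 (a + y * I)) atBot
    (𝓝 (2 * Real.pi * I)) := by
  have h : Tendsto (fun a : ℝ => ∫ y in (-Real.pi)..Real.pi, hankelKernel 1 (a + y * I)) atBot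
      (𝓝 (∫ _ in (-Real.pi)..Real.pi, (1 : ℂ))) := by
    refine intervalIntegral.tendsto_integral_filter_of_dominated_convergence
      (fun _ => Real.exp 1) ?_ ?_ ?_ ?_
    · exact Eventually.of_forall fun a =>
        ((differentiable_hankelKernel 1).continuous.comp (by fun_prop)).aestronglyMeasurable
    · filter_upwards [eventually_le_atBot 0] with a ha
      refine Eventually.of_forall fun y _ => ?_
      rw [norm_hankelKernel]
      apply Real.exp_le_exp.2
      have h1 : (exp (a + y * I)).re ≤ ‖exp (a + y * I)‖ := re_le_norm _
      rw [norm_exp] at h1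
      have h2 : Real.exp (a + y * I : ℂ).re ≤ 1 := by simpa using ha
      linarith
    · exact intervalIntegrable_const
    · refine Eventually.of_forall fun y _ => ?_
      have e : Tendsto (fun a : ℝ => exp (a + y * I)) atBot (𝓝 0) := by
        rw [tendsto_zero_iff_norm_tendsto_zero]
        simpa [norm_exp] using Real.tendsto_exp_atBot
      have := (continuous_exp.tendsto 0).comp e
      rw [exp_zero] at this
      refine this.congr fun a => ?_
      simp [hankelKernel]
  have := h.const_mul I
  convert this using 2
  simp
  ring

/-- For `b = 1` the kernel has period `2πi`, so the rays at height `±π` cancel. Only the segment is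
left, and on it the kernel tends to `1` as it moves to the left. -/
lemma stripIntegral_hankelKernel_one (a : ℝ) :
    stripIntegral a Real.pi (hankelKernel 1) = 2 * Real.pi * I := by
  refine tendsto_nhds_unique ?_ tendsto_segment_one
  refine tendsto_const_nhds.congr fun T => ?_
  rw [stripIntegral_hankelKernel_eq 1 (by linarith [Real.pi_pos]) le_rfl a T, stripIntegral]
  have : ∀ x : ℝ, hankelKernel 1 (x + (Real.pi : ℝ) * I)
      = hankelKernel 1 (x + (-Real.pi : ℝ) * I) := by
    intro x
    simp [hankelKernel, exp_add]
  simp only [this, sub_self, zero_add]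

lemma tendsto_integral_Gamma {b : ℝ} (hb : b < 1) :
    Tendsto (fun a : ℝ => ∫ x in Ioi a, Real.exp (-Real.exp x) * Real.exp ((1 - b) * x)) atBot
      (𝓝 (Real.Gamma (1 - b))) := by
  have hs : 0 < 1 - b := by linarith
  have h1 : ∀ a : ℝ, ∫ x in Ioi a, Real.exp (-Real.exp x) * Real.exp ((1 - b) * x)
      = ∫ y in Ioi (Real.exp a), Real.exp (-y) * y ^ (1 - b - 1) := by
    intro a
    rw [← integral_comp_exp_Ioi]
    refine integral_congr_ae (Eventually.of_forall fun x => ?_)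
    simp only [smul_eq_mul]
    rw [← Real.exp_mul, show (1 - b) * x = x + x * (1 - b - 1) by ring, Real.exp_add]
    ring
  simp only [h1]
  have hcov : AECover (volume.restrict (Ioi (0 : ℝ))) atBot fun a : ℝ => Ioi (Real.exp a) :=
    aecover_Ioi_of_Ioi Real.tendsto_exp_atBot
  have := hcov.integral_tendsto_of_countably_generated (Real.GammaIntegral_convergent hs)
  rw [← Real.Gamma_eq_integral hs] at this
  refine this.congr fun a => ?_
  rw [Measure.restrict_restrict measurableSet_Ioi, inter_eq_left.2]
  exact Ioi_subset_Ioi (Real.exp_pos a).le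

/-- As the left edge goes to `-∞`, the segment vanishes because `b < 1`. The rays at height `±π`
carry conjugate phases and contribute `2i sin(πb) Γ(1 - b)`; the reflection formula finishes. -/
lemma stripIntegral_hankelKernel_of_lt_one {b : ℝ} (h0 : 0 < b) (hb : b < 1) (a : ℝ) :
    stripIntegral a Real.pi (hankelKernel b) = 2 * Real.pi * I / (Real.Gamma b : ℂ) := by
  have hπ := Real.pi_pos
  have hray : ∀ T : ℝ, (∫ x in Ioi T, hankelKernel b ((x : ℝ) + (Real.pi : ℝ) * I))
      - (∫ x in Ioi T, hankelKernel b ((x : ℝ) + (-Real.pi : ℝ) * I))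
      = 2 * I * Real.sin (Real.pi * b) *
        ((∫ x in Ioi T, Real.exp (-Real.exp x) * Real.exp ((1 - b) * x) : ℝ) : ℂ) := by
    intro T
    have e : ∀ ε : ℝ, exp ((ε : ℂ) * I) = -1 → ∀ x : ℝ, hankelKernel b ((x : ℝ) + (ε : ℝ) * I)
        = exp ((1 - b : ℝ) * (ε * I)) *
          ((Real.exp (-Real.exp x) * Real.exp ((1 - b) * x) : ℝ) : ℂ) := by
      intro ε hε x
      rw [hankelKernel, exp_add, hε, mul_add, exp_add]
      push_cast
      ring_nf
    rw [← integral_complex_ofReal]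
    simp only [e Real.pi exp_pi_mul_I, e (-Real.pi) (by simp [exp_neg])]
    rw [integral_const_mul, integral_const_mul, ← sub_mul]
    congr 1
    have : ∀ ε : ℝ, ((1 - b : ℝ) : ℂ) * (ε * I) = ((1 - b) * ε : ℝ) * I := by
      intro ε; push_cast; ring
    rw [this, this, exp_mul_I, exp_mul_I, ← ofReal_cos, ← ofReal_cos, ← ofReal_sin, ← ofReal_sin,
      mul_neg, Real.cos_neg, Real.sin_neg, show (1 - b) * Real.pi = Real.pi - Real.pi * b by ring,
      Real.sin_pi_sub]
    push_cast
    ring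
  have hseg : Tendsto (fun T : ℝ => I * ∫ y in (-Real.pi)..Real.pi, hankelKernel b (T + y * I))
      atBot (𝓝 0) := by
    have h : ∀ T : ℝ, T ≤ 0 → ‖I * ∫ y in (-Real.pi)..Real.pi, hankelKernel b (T + y * I)‖
        ≤ Real.exp 1 * Real.exp ((1 - b) * T) * |Real.pi - -Real.pi| := by
      intro T hT
      rw [norm_mul, norm_I, one_mul]
      refine intervalIntegral.norm_integral_le_of_norm_le_const fun y _ => ?_
      rw [norm_hankelKernel, ← Real.exp_add]
      apply Real.exp_le_exp.2
      have h1 : (exp (T + y * I)).re ≤ ‖exp (T + y * I)‖ := re_le_norm _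
      rw [norm_exp] at h1
      have h3 : (T + y * I : ℂ).re = T := by simp
      rw [h3] at h1 ⊢
      have h2 : Real.exp T ≤ 1 := by simpa using hT
      linarith
    refine squeeze_zero_norm' ((eventually_le_atBot 0).mono h) ?_
    have : Tendsto (fun T : ℝ => Real.exp ((1 - b) * T)) atBot (𝓝 0) :=
      Real.tendsto_exp_atBot.comp (tendsto_id.const_mul_atBot (by linarith))
    simpa using (this.const_mul (Real.exp 1)).mul_const |Real.pi - -Real.pi|
  have ht := (((continuous_ofReal.tendsto _).comp (tendsto_integral_Gamma hb)).const_mul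
    (2 * I * Real.sin (Real.pi * b) : ℂ)).add hseg
  have hconst : Tendsto (fun _ : ℝ => stripIntegral a Real.pi (hankelKernel b)) atBot
      (𝓝 (stripIntegral a Real.pi (hankelKernel b))) := tendsto_const_nhds
  have := tendsto_nhds_unique (hconst.congr fun T => by
    rw [stripIntegral_hankelKernel_eq b (by linarith) le_rfl a T, stripIntegral, hray]
    rfl) ht
  rw [this, add_zero]
  have hΓ : (Real.Gamma b : ℂ) ≠ 0 := ofReal_ne_zero.2 (Real.Gamma_pos_of_pos h0).ne'
  have hsin : Real.sin (Real.pi * b) ≠ 0 :=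
    (Real.sin_pos_of_pos_of_lt_pi (by positivity) (by nlinarith)).ne'
  have hrefl := Real.Gamma_mul_Gamma_one_sub b
  rw [eq_div_iff hsin] at hrefl
  rw [eq_div_iff hΓ]
  have := congrArg (fun t : ℝ => (t : ℂ)) hrefl
  push_cast at this ⊢
  linear_combination 2 * I * this

/-- Hankel's formula for the reciprocal Gamma function. -/
theorem stripIntegral_hankelKernel {b : ℝ} (hb : 0 < b) {φ : ℝ} (h1 : Real.pi / 2 < φ)
    (h2 : φ ≤ Real.pi) (a : ℝ) :
    stripIntegral a φ (hankelKernel b) = 2 * Real.pi * I / (Real.Gamma b : ℂ) := by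
  rw [stripIntegral_hankelKernel_eq b h1 h2 a a]
  -- The base case is `(0, 1]`; the recursion climbs by one from `b - 1` to `b`.
  have key : ∀ N : ℕ, ∀ b : ℝ, 0 < b → b ≤ N + 1 →
      stripIntegral a Real.pi (hankelKernel b) = 2 * Real.pi * I / (Real.Gamma b : ℂ) := by
    intro N
    induction N with
    | zero =>
      intro b hb hle
      rcases lt_or_eq_of_le hle with h | h
      · exact stripIntegral_hankelKernel_of_lt_one hb (by simpa using h) a
      · have : b = 1 := by simpa using h
        rw [this, stripIntegral_hankelKernel_one]
        simp
    | succ N ih =>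
      intro b hb hle
      by_cases hb1 : b ≤ 1
      · exact ih b hb (by linarith [(Nat.cast_nonneg N : (0 : ℝ) ≤ N)])
      · have hb0 : 0 < b - 1 := by linarith [not_le.1 hb1]
        have h := ih (b - 1) hb0 (by push_cast at hle; linarith)
        rw [stripIntegral_hankelKernel_succ (by linarith [Real.pi_pos]) le_rfl,
          sub_add_cancel] at h
        have hG := Real.Gamma_add_one hb0.ne'
        rw [sub_add_cancel] at hG
        have hΓ : (Real.Gamma (b - 1) : ℂ) ≠ 0 :=
          ofReal_ne_zero.2 (Real.Gamma_pos_of_pos hb0).ne'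
        have hb' : ((b - 1 : ℝ) : ℂ) ≠ 0 := ofReal_ne_zero.2 hb0.ne'
        rw [hG, ofReal_mul, eq_div_iff (mul_ne_zero hb' hΓ)]
        rw [eq_div_iff hΓ] at h
        linear_combination h
  obtain ⟨N, hN⟩ := exists_nat_ge b
  exact key N b hb (by linarith)

end

/-! ### Change of variables and integral representation of the series -/

section

variable {a φ : ℝ}

/-- The substitution `s = exp (q * v)` in a Hankel contour integral. -/
lemma hankelIntegral_eq_stripIntegral {q R : ℝ} (hq : 0 < q) (hR : 0 < R) (θ : ℝ) (f : ℂ → ℂ) :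
    hankelIntegral R θ f = q * stripIntegral (Real.log R / q) (θ / q)
      (fun v => f (exp (q * v)) * exp (q * v)) := by
  have hray : ∀ η : ℝ, (∫ r in Ioi R, f (r * exp (η * I)) * exp (η * I))
      = q * ∫ x in Ioi (Real.log R / q), f (exp (q * ((x : ℝ) + (η / q : ℝ) * I)))
          * exp (q * ((x : ℝ) + (η / q : ℝ) * I)) := by
    intro η
    have h1 := integral_comp_exp_Ioi (fun r : ℝ => f (r * exp (η * I)) * exp (η * I)) (Real.log R)
    rw [Real.exp_log hR] at h1
    have h2 := integral_comp_mul_left_Ioi' (fun x : ℝ => Real.exp x •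
      (f ((Real.exp x : ℝ) * exp (η * I)) * exp (η * I))) (Real.log R / q) hq
    rw [mul_div_cancel₀ _ hq.ne', h1] at h2
    rw [← h2, real_smul]
    congr 1
    refine setIntegral_congr_fun measurableSet_Ioi fun x _ => ?_
    have e : exp (q * ((x : ℝ) + (η / q : ℝ) * I)) = (Real.exp (q * x) : ℝ) * exp (η * I) := by
      rw [ofReal_exp, ← exp_add]
      congr 1
      have : (q : ℂ) ≠ 0 := ofReal_ne_zero.2 hq.ne'
      push_cast
      field_simp
    simp only [e, real_smul]
    ring
  have hseg : (∫ y in (-θ)..θ, f (R * exp (y * I)) * (I * R * exp (y * I)))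
      = q * (I * ∫ y in (-(θ / q))..(θ / q), f (exp (q * ((Real.log R / q : ℝ) + (y : ℝ) * I)))
          * exp (q * ((Real.log R / q : ℝ) + (y : ℝ) * I))) := by
    have h := intervalIntegral.integral_comp_mul_left (a := -(θ / q)) (b := θ / q)
      (fun y : ℝ => f (R * exp (y * I)) * (I * R * exp (y * I))) hq.ne'
    rw [show q * -(θ / q) = -θ by field_simp, mul_div_cancel₀ _ hq.ne'] at h
    have hq' : (q : ℂ) ≠ 0 := ofReal_ne_zero.2 hq.ne'
    rw [← intervalIntegral.integral_const_mul, eq_comm]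
    have e : ∀ y : ℝ, exp (q * ((Real.log R / q : ℝ) + (y : ℝ) * I))
        = R * exp (((q * y : ℝ) : ℂ) * I) := by
      intro y
      rw [← Real.exp_log hR, ofReal_exp, ← exp_add, Real.exp_log hR]
      congr 1
      push_cast
      field_simp
    simp only [e]
    rw [show (fun y : ℝ => I * (f (R * exp (((q * y : ℝ) : ℂ) * I)) *
      (R * exp (((q * y : ℝ) : ℂ) * I)))) = fun y : ℝ => f (R * exp (((q * y : ℝ) : ℂ) * I))
        * (I * R * exp (((q * y : ℝ) : ℂ) * I)) by funext y; ring, h, real_smul,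
      ofReal_inv, mul_inv_cancel_left₀ hq']
  unfold hankelIntegral stripIntegral
  have h2 := hray (-θ)
  rw [neg_div] at h2
  simp only [ofReal_neg] at h2 ⊢
  rw [hray θ, h2, hseg]
  ring

lemma hankelKernel_mul_exp (b q : ℝ) (v : ℂ) :
    hankelKernel b v * exp (q * v) = hankelKernel (b - q) v := by
  rw [hankelKernel, hankelKernel, mul_assoc, ← exp_add]
  congr 2
  push_cast
  ring

lemma one_div_one_sub_eq (x : ℂ) (hx : x ≠ 1) (N : ℕ) :
    1 / (1 - x) = ∑ i ∈ Finset.range N, x ^ i + x ^ N / (1 - x) := by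
  have h1 : x - 1 ≠ 0 := sub_ne_zero.2 hx
  have h2 : 1 - x ≠ 0 := sub_ne_zero.2 hx.symm
  rw [geom_sum_eq hx]
  field_simp
  ring

section Series

variable {ι : Type*} [Fintype ι]

/-- The multinomial theorem splits the power into exponentials, each of which only shifts the index
of the kernel by `∑ j, b j * m j`; Hankel's formula then applies termwise. -/
lemma stripIntegral_pow_sum_exp [DecidableEq ι] {b : ι → ℝ} {β : ℝ} (hb : ∀ j, 0 ≤ b j) (hβ : 0 < β) (z : ι → ℂ)
    (k : ℕ) (h1 : Real.pi / 2 < φ) (h2 : φ ≤ Real.pi) :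
    stripIntegral a φ (fun v => hankelKernel β v * (∑ j, z j * exp ((-b j : ℝ) * v)) ^ k)
      = 2 * Real.pi * I * ∑ m ∈ Finset.piAntidiag (Finset.univ : Finset ι) k,
          (Nat.multinomial Finset.univ m : ℂ) * (∏ j, z j ^ m j) /
            (Real.Gamma (β + ∑ j, b j * (m j : ℝ)) : ℂ) := by
  have e : ∀ v, hankelKernel β v * (∑ j, z j * exp ((-b j : ℝ) * v)) ^ k
      = ∑ m ∈ Finset.piAntidiag (Finset.univ : Finset ι) k,
        ((Nat.multinomial Finset.univ m : ℂ) * ∏ j, z j ^ m j) *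
          hankelKernel (β + ∑ j, b j * (m j : ℝ)) v := by
    intro v
    rw [Finset.sum_pow_eq_sum_piAntidiag, Finset.mul_sum]
    refine Finset.sum_congr rfl fun m _ => ?_
    have : ∏ j, (z j * exp ((-b j : ℝ) * v)) ^ m j
        = (∏ j, z j ^ m j) * exp ((-(∑ j, b j * (m j : ℝ)) : ℝ) * v) := by
      simp only [mul_pow]
      rw [Finset.prod_mul_distrib, ofReal_neg, ofReal_sum, ← Finset.sum_neg_distrib,
        Finset.sum_mul, exp_sum]
      congr 1
      refine Finset.prod_congr rfl fun j _ => ?_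
      rw [← exp_nat_mul]
      congr 1
      push_cast
      ring
    rw [this, ← sub_neg_eq_add β, ← hankelKernel_mul_exp]
    ring
  have hπ := Real.pi_pos
  simp only [e]
  rw [stripIntegral_sum _ (by linarith) (cos_neg_of_mem h1 (by linarith)) fun m _ =>
    ⟨_, _, (stripBound_hankelKernel a φ _).const_mul _⟩, Finset.mul_sum]
  refine Finset.sum_congr rfl fun m _ => ?_
  have : 0 ≤ ∑ j, b j * (m j : ℝ) := Finset.sum_nonneg fun j _ => mul_nonneg (hb j) (by positivity)
  rw [stripIntegral_const_mul, stripIntegral_hankelKernel (by linarith) h1 h2]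
  ring

lemma exists_norm_sum_exp_le {b : ι → ℝ} (hb : ∀ j, 0 < b j) (z : ι → ℂ) :
    ∃ a : ℝ, 0 ≤ a ∧ ∀ v : ℂ, a ≤ v.re → ‖∑ j, z j * exp ((-b j : ℝ) * v)‖ ≤ 1 / 2 := by
  have h : Tendsto (fun x : ℝ => ∑ j, ‖z j‖ * Real.exp (-b j * x)) atTop (𝓝 0) := by
    have : Tendsto (fun x : ℝ => ∑ j, ‖z j‖ * Real.exp (-b j * x)) atTop
        (𝓝 (∑ j, ‖z j‖ * 0)) := tendsto_finsetSum _ fun j _ =>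
      (Real.tendsto_exp_atBot.comp
        (tendsto_id.const_mul_atTop_of_neg (by linarith [hb j]))).const_mul _
    simpa using this
  obtain ⟨a, ha⟩ := eventually_atTop.1 (h.eventually_le_const (by norm_num : (0 : ℝ) < 1 / 2))
  refine ⟨max a 0, le_max_right _ _, fun v hv => ?_⟩
  refine (norm_sum_le _ _).trans ((Finset.sum_congr rfl fun j _ => ?_).trans_le
    (ha v.re ((le_max_left _ _).trans hv)))
  rw [norm_mul, norm_exp, re_ofReal_mul]

/-- The contour integral representation of the multinomial Mittag-Leffler function, over a contour
that is far enough from the origin. -/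
lemma exists_multinomialMittagLeffler_eq [DecidableEq ι] {b : ι → ℝ} {β : ℝ} (hb : ∀ j, 0 < b j) (hβ : 0 < β)
    (z : ι → ℂ) (h1 : Real.pi / 2 < φ) (h2 : φ ≤ Real.pi) :
    ∃ a : ℝ, 0 ≤ a ∧ 2 * Real.pi * I * multinomialMittagLeffler b β z
      = stripIntegral a φ
        (fun v => hankelKernel β v / (1 - ∑ j, z j * exp ((-b j : ℝ) * v))) := by
  obtain ⟨a, ha, hP⟩ := exists_norm_sum_exp_le hb z
  refine ⟨a, ha, ?_⟩
  have hπ := Real.pi_pos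
  have hφ : 0 ≤ φ := by linarith
  have hc : Real.cos φ < 0 := cos_neg_of_mem h1 (by linarith)
  set P : ℂ → ℂ := fun v => ∑ j, z j * exp ((-b j : ℝ) * v) with hPdef
  have hPc : Continuous P := by fun_prop
  have hP' : ∀ v ∈ halfStrip a φ, ‖P v‖ ≤ 1 / 2 := fun v hv => hP v hv.1
  have hne : ∀ v ∈ halfStrip a φ, P v ≠ 1 := fun v hv h => by
    have := hP' v hv
    rw [h, norm_one] at this
    norm_num at this
  have hinv : ∀ v ∈ halfStrip a φ, ‖(1 - P v)⁻¹‖ ≤ 2 := fun v hv => by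
    have h3 : 1 / 2 ≤ ‖1 - P v‖ := by
      have := norm_sub_norm_le 1 (P v)
      rw [norm_one] at this
      linarith [hP' v hv]
    rw [norm_inv, show (2 : ℝ) = (1 / 2)⁻¹ by norm_num]
    exact inv_anti₀ (by norm_num) h3
  set W := weightIntegral a φ |1 - β|
  have hterm : ∀ k, ∀ v ∈ halfStrip a φ,
      ‖hankelKernel β v * P v ^ k‖ ≤ (1 / 2) ^ k * stripWeight |1 - β| v := by
    intro k v hv
    rw [norm_mul, norm_pow, mul_comm]
    exact mul_le_mul (pow_le_pow_left₀ (norm_nonneg _) (hP' v hv) k) (norm_hankelKernel_le _ _)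
      (norm_nonneg _) (by positivity)
  have hrem : ∀ N, ∀ v ∈ halfStrip a φ,
      ‖hankelKernel β v * P v ^ N * (1 - P v)⁻¹‖
        ≤ (1 / 2) ^ N * 2 * stripWeight |1 - β| v := by
    intro N v hv
    rw [norm_mul]
    calc _ ≤ (1 / 2) ^ N * stripWeight |1 - β| v * 2 := mul_le_mul (hterm N v hv) (hinv v hv)
          (norm_nonneg _) (mul_nonneg (by positivity) (stripWeight_pos _ _).le)
      _ = _ := by ring
  have hKc := (differentiable_hankelKernel β).continuous
  have hbt : ∀ k, StripBound a φ ((1 / 2) ^ k) |1 - β| (fun v => hankelKernel β v * P v ^ k) :=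
    fun k => ⟨by fun_prop, hterm k⟩
  have hbr : ∀ N, StripBound a φ ((1 / 2) ^ N * 2) |1 - β|
      (fun v => hankelKernel β v * P v ^ N * (1 - P v)⁻¹) := fun N =>
    ⟨ContinuousOn.mul (by fun_prop) (ContinuousOn.inv₀ (by fun_prop) fun v hv =>
      sub_ne_zero.2 (hne v hv).symm), hrem N⟩
  set J := stripIntegral a φ (fun v => hankelKernel β v / (1 - P v))
  set t : ℕ → ℂ := fun k => stripIntegral a φ (fun v => hankelKernel β v * P v ^ k) with ht
  -- A finite geometric sum with its exact remainder replaces the exchange of an infinite sum and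
  -- the integral.
  have hdecomp : ∀ N, J = ∑ k ∈ Finset.range N, t k
      + stripIntegral a φ (fun v => hankelKernel β v * P v ^ N * (1 - P v)⁻¹) := by
    intro N
    rw [ht, ← stripIntegral_sum _ hφ hc fun k _ => ⟨_, _, hbt k⟩]
    rw [← stripIntegral_add hφ hc (StripBound.sum fun k _ => hbt k) (hbr N)]
    refine stripIntegral_congr hφ fun v hv => ?_
    rw [← Finset.mul_sum, div_eq_mul_one_div, one_div_one_sub_eq _ (hne v hv) N]
    ring
  have hsummable : Summable t := by
    refine Summable.of_norm_bounded (g := fun k => (1 / 2 : ℝ) ^ k * W)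
      ((summable_geometric_of_lt_one (by norm_num) (by norm_num)).mul_right W) fun k => ?_
    exact norm_stripIntegral_le hφ hc (hterm k)
  have hlim : Tendsto (fun N => ∑ k ∈ Finset.range N, t k) atTop (𝓝 J) := by
    rw [tendsto_iff_norm_sub_tendsto_zero]
    refine squeeze_zero (fun _ => norm_nonneg _) (g := fun N => (1 / 2 : ℝ) ^ N * 2 * W)
      (fun N => ?_) ?_
    · rw [norm_sub_rev, hdecomp N, add_sub_cancel_left]
      exact norm_stripIntegral_le hφ hc (hrem N)
    · simpa using ((tendsto_pow_atTop_nhds_zero_of_lt_one (by norm_num : (0 : ℝ) ≤ 1 / 2)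
        (by norm_num)).mul_const 2).mul_const W
  have htsum : ∑' k, t k = J := tendsto_nhds_unique hsummable.hasSum.tendsto_sum_nat hlim
  rw [← htsum, multinomialMittagLeffler, ← tsum_mul_left]
  refine tsum_congr fun k => ?_
  rw [ht]
  exact (stripIntegral_pow_sum_exp (fun j => (hb j).le) hβ z k h1 h2).symm

end Series

/-! ### Plane geometry of sectors -/

section Sector

/-- If `arg ζ > θ`, then `arg ζ - θ` lies in `(0, π)` and has positive sine. Both half-plane
conditions survive positive combinations, which is how `expQ` is treated. -/
lemma abs_arg_le_of_im_nonneg {ζ : ℂ} {θ : ℝ} (hθ : 0 < θ) (h1 : 0 ≤ ζ.im)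
    (h2 : (exp (-θ * I) * ζ).im ≤ 0) : |arg ζ| ≤ θ := by
  have h0 : 0 ≤ arg ζ := arg_nonneg_iff.2 h1
  rw [abs_of_nonneg h0]
  by_contra! h
  have hζ : ζ ≠ 0 := by
    rintro rfl
    rw [arg_zero] at h
    linarith
  have e : (exp (-θ * I) * ζ).im = ‖ζ‖ * Real.sin (arg ζ - θ) := by
    conv_lhs => rw [← norm_mul_exp_arg_mul_I ζ]
    rw [mul_left_comm, ← exp_add, show (-θ * I + arg ζ * I : ℂ) = ((arg ζ - θ : ℝ) : ℂ) * I by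
      push_cast; ring, im_ofReal_mul, exp_ofReal_mul_I_im]
  have hs : 0 < Real.sin (arg ζ - θ) :=
    Real.sin_pos_of_pos_of_lt_pi (by linarith) (by linarith [arg_le_pi ζ])
  rw [e] at h2
  linarith [mul_pos (norm_pos_iff.2 hζ) hs]

/-- A point outside of a sector has a distance from the sector proportional to its modulus. -/
lemma exists_mul_norm_le_norm_sub {θ μ : ℝ} (h1 : θ < μ) (h2 : μ ≤ Real.pi) (h0 : 0 ≤ θ) :
    ∃ c : ℝ, 0 < c ∧ ∀ ζ z : ℂ, |arg ζ| ≤ θ → μ ≤ |arg z| → c * ‖z‖ ≤ ‖ζ - z‖ := by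
  -- The form `‖ζ‖² + ‖z‖² - 2κ‖ζ‖‖z‖` has minimum `(1 - κ²)‖z‖²` in `‖ζ‖`. Truncation at zero
  -- secures `κ² < 1` even for obtuse angles.
  set κ := max 0 (Real.cos (μ - θ)) with hκ
  have hκ0 : 0 ≤ κ := le_max_left _ _
  have hκ1 : κ < 1 := by
    refine max_lt one_pos ?_
    rw [← Real.cos_zero]
    exact Real.cos_lt_cos_of_nonneg_of_le_pi le_rfl (by linarith) (by linarith)
  have hκ2 : 0 < 1 - κ ^ 2 := by nlinarith
  refine ⟨Real.sqrt (1 - κ ^ 2), Real.sqrt_pos.2 hκ2, fun ζ z hζ hz => ?_⟩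
  have hcos : Real.cos (arg ζ - arg z) ≤ κ := by
    refine le_trans ?_ (le_max_right _ _)
    rw [← Real.cos_abs]
    have b1 : μ - θ ≤ |arg ζ - arg z| := by
      have := abs_sub_abs_le_abs_sub (arg z) (arg ζ)
      rw [abs_sub_comm] at this
      linarith
    have b2 : |arg ζ - arg z| ≤ θ + Real.pi := by
      have := abs_sub (arg ζ) (arg z)
      linarith [abs_arg_le_pi z]
    rcases le_total |arg ζ - arg z| Real.pi with h | h
    · exact Real.cos_le_cos_of_nonneg_of_le_pi (by linarith) h b1
    · rw [← Real.cos_two_pi_sub]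
      exact Real.cos_le_cos_of_nonneg_of_le_pi (by linarith) (by linarith) (by linarith)
  have hsq : ‖ζ - z‖ ^ 2 = ‖ζ‖ ^ 2 + ‖z‖ ^ 2 - 2 * (‖ζ‖ * ‖z‖) * Real.cos (arg ζ - arg z) := by
    rw [← normSq_eq_norm_sq, ← normSq_eq_norm_sq, ← normSq_eq_norm_sq, Real.cos_sub,
      normSq_apply, normSq_apply, normSq_apply, sub_re, sub_im]
    have e1 := norm_mul_cos_arg ζ
    have e2 := norm_mul_sin_arg ζ
    have e3 := norm_mul_cos_arg z
    have e4 := norm_mul_sin_arg z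
    rw [← e1, ← e2, ← e3, ← e4]
    ring
  refine abs_le_of_sq_le_sq' ?_ (norm_nonneg _) |>.2
  rw [mul_pow, Real.sq_sqrt hκ2.le, hsq]
  have := mul_le_mul_of_nonneg_left hcos (mul_nonneg (norm_nonneg ζ) (norm_nonneg z))
  nlinarith [sq_nonneg (‖ζ‖ - κ * ‖z‖)]

end Sector

end

/-! ### The function `Q`, the coefficients and the remainder -/

section

variable {n : ℕ} {ρ : Fin (n + 1) → ℝ} {β : ℝ} {a φ : ℝ}

/-- The function `mlQ ρ w` in the variable `v = log s / ρ 0`. -/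
noncomputable def expQ (ρ : Fin (n + 1) → ℝ) (w : Fin n → ℝ) (v : ℂ) : ℂ :=
  exp (ρ 0 * v) - ∑ j : Fin n, (w j : ℂ) * exp (ρ j.succ * v)

lemma differentiable_expQ (ρ : Fin (n + 1) → ℝ) (w : Fin n → ℝ) : Differentiable ℂ (expQ ρ w) := by
  unfold expQ
  fun_prop

lemma exp_mul_cpow {q : ℝ} {v : ℂ} (h : q * |v.im| < Real.pi) (hq : 0 < q) (r : ℝ) :
    exp (q * v) ^ (r : ℂ) = exp ((r * q : ℝ) * v) := by
  have him : ((q : ℂ) * v).im = q * v.im := im_ofReal_mul _ _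
  have h' : |((q : ℂ) * v).im| < Real.pi := by rwa [him, abs_mul, abs_of_pos hq]
  rw [cpow_def_of_ne_zero (exp_ne_zero _), log_exp (abs_lt.1 h').1 (abs_lt.1 h').2.le]
  congr 1
  push_cast
  ring

lemma mlQ_exp (hρ : 0 < ρ 0) (w : Fin n → ℝ) {v : ℂ} (h : ρ 0 * |v.im| < Real.pi) :
    mlQ ρ w (exp (ρ 0 * v)) = expQ ρ w v := by
  rw [mlQ, expQ]
  congr 1
  refine Finset.sum_congr rfl fun j _ => ?_
  rw [exp_mul_cpow h hρ, div_mul_cancel₀ _ hρ.ne']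

lemma norm_expQ_le (hρ_anti : StrictAnti ρ) (hρ_pos : ∀ i, 0 < ρ i) {w : Fin n → ℝ} {K : ℝ}
    (hw : ∀ j, |w j| ≤ K) (v : ℂ) :
    ‖expQ ρ w v‖ ≤ (1 + n * K) * Real.exp (ρ 0 * |v.re|) := by
  have hexp : ∀ i, ‖exp (ρ i * v)‖ ≤ Real.exp (ρ 0 * |v.re|) := fun i => by
    rw [norm_exp, re_ofReal_mul]
    refine Real.exp_le_exp.2 ((mul_le_mul_of_nonneg_left (le_abs_self _) (hρ_pos i).le).trans ?_)
    exact mul_le_mul_of_nonneg_right (hρ_anti.antitone (Fin.zero_le i)) (abs_nonneg _)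
  have hterm : ∀ j, ‖(w j : ℂ) * exp (ρ j.succ * v)‖ ≤ K * Real.exp (ρ 0 * |v.re|) := fun j => by
    rw [norm_mul, norm_real, Real.norm_eq_abs]
    exact mul_le_mul (hw j) (hexp _) (norm_nonneg _) ((abs_nonneg _).trans (hw j))
  refine (norm_sub_le _ _).trans
    ((add_le_add (hexp 0) (norm_sum_le_of_le _ fun j _ => hterm j)).trans_eq ?_)
  rw [Finset.sum_const, Finset.card_univ, Fintype.card_fin, nsmul_eq_mul]
  ring

lemma im_exp_mul_expQ (w : Fin n → ℝ) (v : ℂ) (η : ℝ) :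
    (exp (-η * I) * expQ ρ w v).im = Real.exp (ρ 0 * v.re) * Real.sin (ρ 0 * v.im - η)
      + ∑ j : Fin n, (-w j) * (Real.exp (ρ j.succ * v.re) * Real.sin (ρ j.succ * v.im - η)) := by
  have e : ∀ i, (exp (-η * I) * exp (ρ i * v)).im
      = Real.exp (ρ i * v.re) * Real.sin (ρ i * v.im - η) := by
    intro i
    rw [← exp_add, exp_im]
    congr 2 <;> simp
    ring
  rw [expQ, mul_sub, sub_im, e, Finset.mul_sum, im_sum, sub_eq_add_neg, ← Finset.sum_neg_distrib]
  congr 1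
  refine Finset.sum_congr rfl fun j _ => ?_
  rw [mul_left_comm, im_ofReal_mul, e]
  ring

lemma expQ_conj (w : Fin n → ℝ) (v : ℂ) :
    expQ ρ w ((starRingEnd ℂ) v) = (starRingEnd ℂ) (expQ ρ w v) := by
  simp [expQ, ← exp_conj]

/-- For `0 ≤ im v ≤ φ` each `exp (ρ i * v)` lies in the sector `0 ≤ arg ≤ ρ 0 * φ`. This is a convex
cone because `ρ 0 * φ ≤ π`, and the coefficients `1, -w j` are positive. Conjugation handles `im v ≤
0`. -/
lemma abs_arg_expQ_le (hρ_anti : StrictAnti ρ) (hρ_pos : ∀ i, 0 < ρ i) {w : Fin n → ℝ}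
    (hw : ∀ j, w j < 0) (hφ : 0 < φ) (hφπ : ρ 0 * φ ≤ Real.pi) {v : ℂ} (hv : |v.im| ≤ φ) :
    |arg (expQ ρ w v)| ≤ ρ 0 * φ := by
  have main : ∀ v : ℂ, 0 ≤ v.im → v.im ≤ φ → |arg (expQ ρ w v)| ≤ ρ 0 * φ := by
    intro v h0 h1
    have hle : ∀ i, ρ i * v.im ≤ ρ 0 * φ := fun i =>
      mul_le_mul (hρ_anti.antitone (Fin.zero_le i)) h1 h0 (hρ_pos 0).le
    have hnn : ∀ i, 0 ≤ ρ i * v.im := fun i => mul_nonneg (hρ_pos i).le h0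
    refine abs_arg_le_of_im_nonneg (mul_pos (hρ_pos 0) hφ) ?_ ?_
    · have h := im_exp_mul_expQ (ρ := ρ) w v 0
      simp only [ofReal_zero, neg_zero, zero_mul, exp_zero, one_mul, sub_zero] at h
      have hs : ∀ i, 0 ≤ Real.exp (ρ i * v.re) * Real.sin (ρ i * v.im) := fun i =>
        mul_nonneg (Real.exp_pos _).le
          (Real.sin_nonneg_of_nonneg_of_le_pi (hnn i) ((hle i).trans hφπ))
      rw [h]
      exact add_nonneg (hs 0) (Finset.sum_nonneg fun j _ =>
        mul_nonneg (by linarith [hw j]) (hs _))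
    · rw [im_exp_mul_expQ]
      have hs : ∀ i, Real.exp (ρ i * v.re) * Real.sin (ρ i * v.im - ρ 0 * φ) ≤ 0 := fun i =>
        mul_nonpos_of_nonneg_of_nonpos (Real.exp_pos _).le
          (Real.sin_nonpos_of_nonpos_of_neg_pi_le (by linarith [hle i]) (by linarith [hnn i]))
      exact add_nonpos (hs 0) (Finset.sum_nonpos fun j _ =>
        mul_nonpos_of_nonneg_of_nonpos (by linarith [hw j]) (hs _))
  rcases le_total 0 v.im with h | h
  · exact main v h ((le_abs_self _).trans hv)
  · have := main ((starRingEnd ℂ) v) (by simpa using h)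
      (by rw [conj_im]; exact (neg_le_abs _).trans hv)
    rw [expQ_conj, arg_conj] at this
    split_ifs at this with hπ
    · rwa [hπ]
    · rwa [abs_neg] at this

lemma norm_hankelKernel_mul_expQ_pow_le (hρ_anti : StrictAnti ρ) (hρ_pos : ∀ i, 0 < ρ i)
    {w : Fin n → ℝ} {K : ℝ} (hw : ∀ j, |w j| ≤ K) (b : ℝ) (m : ℕ) (v : ℂ) :
    ‖hankelKernel b v * expQ ρ w v ^ m‖
      ≤ (1 + n * K) ^ m * stripWeight (|1 - b| + m * ρ 0) v := by
  have e : stripWeight (|1 - b| + m * ρ 0) v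
      = stripWeight |1 - b| v * Real.exp (ρ 0 * |v.re|) ^ m := by
    rw [stripWeight, stripWeight, ← Real.exp_nat_mul, ← Real.exp_add]
    congr 1
    ring
  rw [norm_mul, norm_pow, e]
  calc _ ≤ stripWeight |1 - b| v * ((1 + n * K) * Real.exp (ρ 0 * |v.re|)) ^ m := by
        gcongr
        · exact (stripWeight_pos _ _).le
        · exact norm_hankelKernel_le b v
        · exact norm_expQ_le hρ_anti hρ_pos hw v
    _ = _ := by rw [mul_pow]; ring

lemma stripBound_hankelKernel_mul_expQ_pow (hρ_anti : StrictAnti ρ) (hρ_pos : ∀ i, 0 < ρ i)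
    {w : Fin n → ℝ} {K : ℝ} (hw : ∀ j, |w j| ≤ K) (b : ℝ) (m : ℕ) :
    StripBound a φ ((1 + n * K) ^ m) (|1 - b| + m * ρ 0)
      (fun v => hankelKernel b v * expQ ρ w v ^ m) :=
  ⟨((differentiable_hankelKernel b).continuous.mul
    ((differentiable_expQ ρ w).continuous.pow m)).continuousOn,
    fun v _ => norm_hankelKernel_mul_expQ_pow_le hρ_anti hρ_pos hw b m v⟩

lemma exists_abs_le (w : Fin n → ℝ) : ∃ K, ∀ j, |w j| ≤ K :=
  ⟨∑ j, |w j|, fun j => Finset.single_le_sum (f := fun j => |w j|) (fun _ _ => abs_nonneg _)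
    (Finset.mem_univ j)⟩

/-- The coefficient of `-z ^ (-k)` in the asymptotic expansion. -/
noncomputable def expansionCoeff (ρ : Fin (n + 1) → ℝ) (β : ℝ) (k : ℕ) (w : Fin n → ℝ) : ℂ :=
  (2 * Real.pi * I)⁻¹ * stripIntegral 0 Real.pi
    (fun v => hankelKernel (β - ρ 0) v * expQ ρ w v ^ (k - 1))

/-- The integrand is entire, so neither the left edge nor the height matters; hence the coefficient
is independent of `R` and `θ`. -/
lemma two_pi_I_mul_expansionCoeff (hρ_anti : StrictAnti ρ) (hρ_pos : ∀ i, 0 < ρ i)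
    (h1 : Real.pi / 2 < φ) (h2 : φ ≤ Real.pi) (a : ℝ) (k : ℕ) (w : Fin n → ℝ) :
    2 * Real.pi * I * expansionCoeff ρ β k w
      = stripIntegral a φ (fun v => hankelKernel (β - ρ 0) v * expQ ρ w v ^ (k - 1)) := by
  have hπ := Real.pi_pos
  have hc : Real.cos Real.pi < 0 := by simp
  obtain ⟨K, hK⟩ := exists_abs_le w
  have hb : ∀ a, StripBound a Real.pi _ _ _ := fun a =>
    stripBound_hankelKernel_mul_expQ_pow hρ_anti hρ_pos hK (β - ρ 0) (k - 1)
  have hd : ∀ s, DifferentiableOn ℂ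
      (fun v => hankelKernel (β - ρ 0) v * expQ ρ w v ^ (k - 1)) s := fun s =>
    ((differentiable_hankelKernel _).mul ((differentiable_expQ ρ w).pow _)).differentiableOn
  rw [expansionCoeff, mul_inv_cancel_left₀ two_pi_I_ne_zero,
    stripIntegral_angle_eq_of_le h2 h1 (by linarith) (hb a) (hd _)]
  rcases le_total a 0 with h | h
  · exact (stripIntegral_eq_of_le h hπ.le hc (hb a) (hd _)).symm
  · exact stripIntegral_eq_of_le h hπ.le hc (hb 0) (hd _)

lemma expansionCoeff_eq_hankelIntegral (hρ_lt_one : ρ 0 < 1) (hρ_anti : StrictAnti ρ)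
    (hρ_pos : ∀ i, 0 < ρ i) (k : ℕ) (w : Fin n → ℝ) {R θ : ℝ} (hR : 0 < R)
    (h1 : ρ 0 * Real.pi / 2 < θ) (h2 : θ < ρ 0 * Real.pi) :
    expansionCoeff ρ β k w = 1 / (2 * (ρ 0 : ℂ) * (Real.pi : ℂ) * I) *
      hankelIntegral R θ (fun s : ℂ => exp (s ^ ((1 / ρ 0 : ℝ) : ℂ)) *
        s ^ (((1 - β) / ρ 0 : ℝ) : ℂ) * mlQ ρ w s ^ (k - 1)) := by
  have hπ := Real.pi_pos
  have hρ := hρ_pos 0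
  have l1 : Real.pi / 2 < θ / ρ 0 := by rw [lt_div_iff₀ hρ]; linarith
  have l2 : θ / ρ 0 < Real.pi := by rw [div_lt_iff₀ hρ]; linarith
  rw [hankelIntegral_eq_stripIntegral hρ hR]
  rw [stripIntegral_congr (g := fun v => hankelKernel (β - ρ 0) v * expQ ρ w v ^ (k - 1))
    (by linarith), ← two_pi_I_mul_expansionCoeff hρ_anti hρ_pos l1 l2.le]
  · have : (ρ 0 : ℂ) ≠ 0 := ofReal_ne_zero.2 hρ.ne'
    have : (Real.pi : ℂ) ≠ 0 := ofReal_ne_zero.2 hπ.ne'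
    have := I_ne_zero
    field_simp
  · intro v hv
    -- Here `ρ 0 < 1` keeps the contour off the cut, so the principal powers of `exp (ρ 0 * v)` are
    -- exponentials.
    have hlt : ρ 0 * |v.im| < Real.pi := by nlinarith [hv.2, abs_nonneg v.im]
    rw [mlQ_exp hρ w hlt, exp_mul_cpow hlt hρ, exp_mul_cpow hlt hρ, div_mul_cancel₀ _ hρ.ne',
      div_mul_cancel₀ _ hρ.ne', ← hankelKernel_mul_exp, hankelKernel, ofReal_one, one_mul]
    ring

lemma expansionCoeff_one (hρ_anti : StrictAnti ρ) (hρ_pos : ∀ i, 0 < ρ i) (hβ : 2 * ρ 0 < β)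
    (w : Fin n → ℝ) : expansionCoeff ρ β 1 w = 1 / (Real.Gamma (β - ρ 0) : ℂ) := by
  have h := two_pi_I_mul_expansionCoeff (β := β) hρ_anti hρ_pos
    (by linarith [Real.pi_pos]) le_rfl 0 1 w
  simp only [Nat.sub_self, pow_zero, mul_one] at h
  rw [stripIntegral_hankelKernel (by linarith [hρ_pos 0]) (by linarith [Real.pi_pos]) le_rfl,
    div_eq_mul_one_div] at h
  exact mul_left_cancel₀ two_pi_I_ne_zero h

lemma expansionCoeff_two (hρ_anti : StrictAnti ρ) (hρ_pos : ∀ i, 0 < ρ i) (hβ : 2 * ρ 0 < β)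
    (w : Fin n → ℝ) :
    expansionCoeff ρ β 2 w = 1 / (Real.Gamma (β - 2 * ρ 0) : ℂ)
      - ∑ j : Fin n, (w j : ℂ) / (Real.Gamma (β - ρ 0 - ρ j.succ) : ℂ) := by
  have hπ := Real.pi_pos
  have h := two_pi_I_mul_expansionCoeff (β := β) hρ_anti hρ_pos
    (by linarith) le_rfl 0 2 w
  have e : ∀ v, hankelKernel (β - ρ 0) v * expQ ρ w v ^ (2 - 1)
      = ∑ i : Fin (n + 1), (Fin.cons 1 (fun j => -(w j : ℂ)) : Fin (n + 1) → ℂ) i *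
        hankelKernel (β - ρ 0 - ρ i) v := by
    intro v
    simp only [← hankelKernel_mul_exp _ (ρ _)]
    rw [Fin.sum_univ_succ, Nat.add_one_sub_one, pow_one, expQ, mul_sub, Finset.mul_sum,
      sub_eq_add_neg, ← Finset.sum_neg_distrib]
    simp only [Fin.cons_zero, Fin.cons_succ, one_mul]
    congr 1
    refine Finset.sum_congr rfl fun j _ => ?_
    ring
  -- The hypothesis `β > 2ρ₁` makes every index positive, as Hankel's formula requires.
  have hpos : ∀ i, 0 < β - ρ 0 - ρ i := fun i => by
    linarith [hρ_anti.antitone (Fin.zero_le i)]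
  simp only [e] at h
  rw [stripIntegral_sum _ hπ.le (by simp) fun i _ =>
    ⟨_, _, (stripBound_hankelKernel 0 Real.pi _).const_mul _⟩] at h
  simp only [stripIntegral_const_mul, stripIntegral_hankelKernel (hpos _)
    (by linarith : Real.pi / 2 < Real.pi) le_rfl] at h
  refine mul_left_cancel₀ two_pi_I_ne_zero (h.trans ?_)
  rw [Fin.sum_univ_succ, mul_sub, Finset.mul_sum, sub_eq_add_neg (_ * _),
    ← Finset.sum_neg_distrib]
  simp only [Fin.cons_zero, Fin.cons_succ, one_mul]
  rw [show β - ρ 0 - ρ 0 = β - 2 * ρ 0 by ring]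
  congr 1
  · ring
  · refine Finset.sum_congr rfl fun j _ => ?_
    ring

/-- The contour integral representation of the multinomial Mittag-Leffler function over a fixed
contour. -/
lemma multinomialMittagLeffler_eq (hρ_anti : StrictAnti ρ) (hρ_pos : ∀ i, 0 < ρ i)
    (hβ : 2 * ρ 0 < β) (h1 : Real.pi / 2 < φ) (h2 : φ ≤ Real.pi) {κ : ℝ} (hκ : 0 < κ) {z : ℂ}
    (w : Fin n → ℝ)
    (hQ : ∀ v : ℂ, |v.im| ≤ φ → κ ≤ ‖expQ ρ w v - z‖) :
    2 * Real.pi * I *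
      multinomialMittagLeffler (rhoPrime ρ) β (Fin.cons z (fun j => (w j : ℂ)))
      = stripIntegral 0 φ (fun v => hankelKernel (β - ρ 0) v / (expQ ρ w v - z)) := by
  have hπ := Real.pi_pos
  have hb : ∀ j, 0 < rhoPrime ρ j := by
    intro j
    refine Fin.cases ?_ (fun j => ?_) j
    · simpa [rhoPrime] using hρ_pos 0
    · simpa [rhoPrime] using hρ_anti (Fin.succ_pos j)
  obtain ⟨a, ha, h⟩ := exists_multinomialMittagLeffler_eq hb (by linarith [hρ_pos 0] : 0 < β)
    (Fin.cons z (fun j => (w j : ℂ))) h1 h2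
  have hne : ∀ v : ℂ, |v.im| ≤ φ → expQ ρ w v - z ≠ 0 := fun v hv =>
    norm_pos_iff.1 (hκ.trans_le (hQ v hv))
  have hbound : StripBound 0 φ κ⁻¹ |1 - (β - ρ 0)|
      (fun v => hankelKernel (β - ρ 0) v / (expQ ρ w v - z)) := by
    refine ⟨ContinuousOn.div (differentiable_hankelKernel _).continuous.continuousOn
      ((differentiable_expQ ρ w).continuous.sub continuous_const).continuousOn
      fun v hv => hne v hv.2, fun v hv => ?_⟩
    rw [norm_div, div_eq_inv_mul]
    exact mul_le_mul (inv_anti₀ hκ (hQ v hv.2)) (norm_hankelKernel_le _ _) (norm_nonneg _)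
      (by positivity)
  -- The edge `a` depends on `z` and `w`. It moves back to `0` because the denominator has no zero
  -- in the strip.
  rw [h, stripIntegral_eq_of_le ha (by linarith) (cos_neg_of_mem h1 (by linarith)) hbound
    (DifferentiableOn.div (differentiable_hankelKernel _).differentiableOn
      ((differentiable_expQ ρ w).sub_const z).differentiableOn fun v hv => hne v hv.2)]
  refine stripIntegral_congr (by linarith) fun v hv => ?_
  have e : exp (ρ 0 * v) * (1 - ∑ j, (Fin.cons z (fun j => (w j : ℂ)) : Fin (n + 1) → ℂ) j *
      exp ((-rhoPrime ρ j : ℝ) * v)) = expQ ρ w v - z := by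
    rw [Fin.sum_univ_succ, expQ, mul_sub, mul_add, Finset.mul_sum, mul_one]
    simp only [rhoPrime, Fin.cons_zero, Fin.cons_succ]
    rw [mul_left_comm, ← exp_add]
    have e1 : (ρ 0 : ℂ) * v + (-ρ 0 : ℝ) * v = 0 := by push_cast; ring
    have e2 : ∀ j : Fin n, exp (ρ 0 * v) * ((w j : ℂ) * exp ((-(ρ 0 - ρ j.succ) : ℝ) * v))
        = w j * exp (ρ j.succ * v) := by
      intro j
      rw [mul_left_comm, ← exp_add]
      congr 2
      push_cast
      ring
    simp only [e1, e2, exp_zero]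
    ring
  rw [← e, ← hankelKernel_mul_exp, mul_comm (hankelKernel β v),
    mul_div_mul_left _ _ (exp_ne_zero _)]

/-- The asymptotic expansion with an explicit remainder bound. -/
lemma norm_multinomialMittagLeffler_add_sum_le (hρ_anti : StrictAnti ρ) (hρ_pos : ∀ i, 0 < ρ i)
    (hβ : 2 * ρ 0 < β) (h1 : Real.pi / 2 < φ) (h2 : φ ≤ Real.pi) {κ K : ℝ} (hκ : 0 < κ) {z : ℂ}
    (hz : z ≠ 0) {w : Fin n → ℝ} (hw : ∀ j, |w j| ≤ K)
    (hQ : ∀ v : ℂ, |v.im| ≤ φ → κ * ‖z‖ ≤ ‖expQ ρ w v - z‖) (p : ℕ) :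
    ‖multinomialMittagLeffler (rhoPrime ρ) β (Fin.cons z (fun j => (w j : ℂ)))
      + ∑ i ∈ Finset.range p, expansionCoeff ρ β (i + 1) w / z ^ (i + 1)‖
      ≤ ‖(2 * Real.pi * I : ℂ)⁻¹‖ * ((1 + n * K) ^ p * κ⁻¹ *
        weightIntegral 0 φ (|1 - (β - ρ 0)| + p * ρ 0)) * (‖z‖ ^ (p + 1))⁻¹ := by
  have hπ := Real.pi_pos
  have hφ : 0 ≤ φ := by linarith
  have hc := cos_neg_of_mem h1 (by linarith)
  have hz' : 0 < ‖z‖ := norm_pos_iff.2 hz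
  have hne : ∀ v : ℂ, |v.im| ≤ φ → expQ ρ w v - z ≠ 0 := fun v hv =>
    norm_pos_iff.1 ((mul_pos hκ hz').trans_le (hQ v hv))
  set B := weightIntegral 0 φ (|1 - (β - ρ 0)| + p * ρ 0)
  set r : ℂ → ℂ := fun v =>
    (z ^ p)⁻¹ * (hankelKernel (β - ρ 0) v * expQ ρ w v ^ p * (expQ ρ w v - z)⁻¹) with hr
  set t : ℕ → ℂ → ℂ := fun i v =>
    -(z ^ (i + 1))⁻¹ * (hankelKernel (β - ρ 0) v * expQ ρ w v ^ (i + 1 - 1)) with ht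
  have htb : ∀ i, StripBound 0 φ _ _ (t i) := fun i =>
    (stripBound_hankelKernel_mul_expQ_pow hρ_anti hρ_pos hw (β - ρ 0) (i + 1 - 1)).const_mul _
  have hrle : ∀ v ∈ halfStrip 0 φ, ‖r v‖ ≤ (‖z‖ ^ (p + 1))⁻¹ * ((1 + n * K) ^ p * κ⁻¹)
      * stripWeight (|1 - (β - ρ 0)| + p * ρ 0) v := by
    intro v hv
    rw [hr, norm_mul, norm_mul, norm_inv, norm_inv, norm_pow]
    have b1 := norm_hankelKernel_mul_expQ_pow_le hρ_anti hρ_pos hw (β - ρ 0) p v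
    have b2 := inv_anti₀ (mul_pos hκ hz') (hQ v hv.2)
    calc _ ≤ (‖z‖ ^ p)⁻¹ * ((1 + n * K) ^ p * stripWeight (|1 - (β - ρ 0)| + p * ρ 0) v *
          (κ * ‖z‖)⁻¹) := by
          refine mul_le_mul_of_nonneg_left ?_ (by positivity)
          exact mul_le_mul b1 b2 (by positivity) ((norm_nonneg _).trans b1)
      _ = _ := by
        rw [mul_inv, pow_succ, mul_inv]
        ring
  have hrb : StripBound 0 φ _ _ r := ⟨ContinuousOn.mul continuousOn_const
    (ContinuousOn.mul ((differentiable_hankelKernel _).continuous.mul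
      ((differentiable_expQ ρ w).continuous.pow p)).continuousOn
      (ContinuousOn.inv₀ ((differentiable_expQ ρ w).continuous.sub continuous_const).continuousOn
        fun v hv => hne v hv.2)), hrle⟩
  have hdecomp : 2 * Real.pi * I *
      (multinomialMittagLeffler (rhoPrime ρ) β (Fin.cons z (fun j => (w j : ℂ)))
      + ∑ i ∈ Finset.range p, expansionCoeff ρ β (i + 1) w / z ^ (i + 1))
      = stripIntegral 0 φ r := by
    have hsum := stripIntegral_sum (a := 0) (Finset.range p) hφ hc fun i _ => ⟨_, _, htb i⟩
    rw [mul_add, multinomialMittagLeffler_eq hρ_anti hρ_pos hβ h1 h2 (mul_pos hκ hz') w hQ]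
    -- This is `1 / (Q - z) = -∑_{i < p} Q^i / z^(i+1) + z^(-p) Q^p / (Q - z)`; no smallness of `Q /
    -- z` is needed.
    have e : ∀ v ∈ halfStrip 0 φ, hankelKernel (β - ρ 0) v / (expQ ρ w v - z)
        = (∑ i ∈ Finset.range p, t i v) + r v := by
      intro v hv
      have hx : expQ ρ w v / z ≠ 1 := fun h => hne v hv.2 (by
        rw [div_eq_one_iff_eq hz] at h
        rw [h, sub_self])
      have h3 := one_div_one_sub_eq _ hx p
      have h4 : (expQ ρ w v - z)⁻¹ = -z⁻¹ * (1 / (1 - expQ ρ w v / z)) := by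
        have := hne v hv.2
        have h5 : z - expQ ρ w v ≠ 0 := by rw [← neg_sub]; exact neg_ne_zero.2 this
        rw [← neg_sub z, one_sub_div hz]
        field_simp
      have h6 : r v = hankelKernel (β - ρ 0) v * (-z⁻¹ *
          ((expQ ρ w v / z) ^ p / (1 - expQ ρ w v / z))) := by
        simp only [hr]
        rw [h4, div_pow]
        ring
      rw [div_eq_mul_inv, h4, h3, h6, mul_add, mul_add, Finset.mul_sum, Finset.mul_sum]
      congr 1
      refine Finset.sum_congr rfl fun i _ => ?_
      simp only [ht, Nat.add_sub_cancel, div_pow, pow_succ, mul_inv]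
      ring
    have hsb := StripBound.sum fun i (hi : i ∈ Finset.range p) =>
      (htb i).mono_weight (c' := |1 - (β - ρ 0)| + p * ρ 0) hφ (by
        have : ((i + 1 - 1 : ℕ) : ℝ) ≤ p := Nat.cast_le.2 (by simpa using (Finset.mem_range.1 hi).le)
        have := mul_le_mul_of_nonneg_right this (hρ_pos 0).le
        linarith)
    rw [stripIntegral_congr hφ e, stripIntegral_add hφ hc hsb hrb, hsum, add_assoc, add_comm,
      add_assoc, Finset.mul_sum, ← Finset.sum_add_distrib, Finset.sum_eq_zero, add_zero]
    intro i _
    have h7 := two_pi_I_mul_expansionCoeff (β := β) hρ_anti hρ_pos h1 h2 0 (i + 1) w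
    simp only [ht]
    rw [stripIntegral_const_mul, ← h7]
    ring
  have := norm_stripIntegral_le hφ hc hrle
  rw [← hdecomp, norm_mul] at this
  have h8 : 0 < ‖(2 * Real.pi * I : ℂ)‖ := norm_pos_iff.2 two_pi_I_ne_zero
  rw [norm_inv]
  have h9 := mul_le_mul_of_nonneg_left this (inv_nonneg.2 h8.le)
  rw [inv_mul_cancel_left₀ h8.ne'] at h9
  refine h9.trans_eq ?_
  ring

end

end MultinomialMittagLeffler

/-! ### The asymptotic expansion -/

theorem theorem1 (n : ℕ) (ρ : Fin (n + 1) → ℝ) (β : ℝ)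
    (hρ_lt_one : ρ 0 < 1) (hρ_anti : StrictAnti ρ) (hρ_pos : ∀ i, 0 < ρ i)
    (hβ : 2 * ρ 0 < β) :
    ∃ C : ℕ → (Fin n → ℝ) → ℂ,
      (∀ k : ℕ, 3 ≤ k → ∀ w : Fin n → ℝ, (∀ j, w j < 0) →
        ∀ R θ : ℝ, 0 < R → ρ 0 * Real.pi / 2 < θ → θ < ρ 0 * Real.pi →
          C k w = 1 / (2 * (ρ 0 : ℂ) * (Real.pi : ℂ) * Complex.I) *
            hankelIntegral R θ (fun s : ℂ =>
              Complex.exp (s ^ ((1 / ρ 0 : ℝ) : ℂ)) * s ^ (((1 - β) / ρ 0 : ℝ) : ℂ) *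
                mlQ ρ w s ^ (k - 1))) ∧
      ∀ μ K : ℝ, ρ 0 * Real.pi / 2 < μ → μ < ρ 0 * Real.pi → 0 < K →
        ∀ p : ℕ, 1 ≤ p →
          ∃ D r : ℝ, 0 < D ∧ 0 < r ∧
            ∀ (z : ℂ) (w : Fin n → ℝ), r ≤ ‖z‖ → μ ≤ |Complex.arg z| → |Complex.arg z| ≤ Real.pi →
              (∀ j, -K ≤ w j ∧ w j < 0) →
              ‖multinomialMittagLeffler (rhoPrime ρ) β (Fin.cons z (fun j => (w j : ℂ)))
                - (- (1 / z) * (1 / (Real.Gamma (β - ρ 0) : ℂ))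
                    - 1 / z ^ 2 * (1 / (Real.Gamma (β - 2 * ρ 0) : ℂ)
                        - ∑ j : Fin n, (w j : ℂ) / (Real.Gamma (β - ρ 0 - ρ j.succ) : ℂ))
                    - ∑ k ∈ Finset.Icc 3 p, C k w / z ^ k)‖
                ≤ D * (‖z‖ ^ (p + 1))⁻¹ := by
  have hπ := Real.pi_pos
  have hρ0 := hρ_pos 0
  refine ⟨MultinomialMittagLeffler.expansionCoeff ρ β, fun k _ w _ R θ hR h1 h2 =>
    MultinomialMittagLeffler.expansionCoeff_eq_hankelIntegral hρ_lt_one hρ_anti hρ_pos k w hR h1 h2,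
    fun μ K hμ1 hμ2 hK p hp => ?_⟩
  have hμπ : μ ≤ Real.pi := by nlinarith
  -- Above `ρ₁π/2` the integrals converge; below `μ` the values of `Q` stay away from `z`.
  obtain ⟨θ, hθ1, hθ2⟩ := exists_between hμ1
  have hφ1 : Real.pi / 2 < θ / ρ 0 := by rw [lt_div_iff₀ hρ0]; linarith
  have hφ2 : θ / ρ 0 ≤ Real.pi := by rw [div_le_iff₀ hρ0]; linarith
  have hθφ : ρ 0 * (θ / ρ 0) = θ := mul_div_cancel₀ _ hρ0.ne'
  have hθ0 : 0 < θ := lt_trans (by positivity) hθ1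
  obtain ⟨κ, hκ, hdist⟩ :=
    MultinomialMittagLeffler.exists_mul_norm_le_norm_sub hθ2 hμπ hθ0.le
  set D : ℕ → ℝ := fun q => ‖(2 * Real.pi * Complex.I : ℂ)⁻¹‖ * ((1 + n * K) ^ q * κ⁻¹ *
    MultinomialMittagLeffler.weightIntegral 0 (θ / ρ 0) (|1 - (β - ρ 0)| + q * ρ 0)) with hD
  -- The `z⁻²` term is displayed even for `p = 1`, so at least two terms are expanded; `‖z‖ ≥ 1`
  -- then allows the weaker power. The maximum with `1` only secures a positive constant.
  refine ⟨max (D (max p 2)) 1, 1, lt_max_of_lt_right one_pos, one_pos,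
    fun z w hz hz1 _ hw => ?_⟩
  have hz0 : z ≠ 0 := norm_pos_iff.1 (by linarith)
  have hwK : ∀ j, |w j| ≤ K := fun j => abs_le.2 ⟨(hw j).1, by linarith [(hw j).2]⟩
  have hbound := MultinomialMittagLeffler.norm_multinomialMittagLeffler_add_sum_le hρ_anti hρ_pos
    hβ hφ1 hφ2 hκ hz0 hwK (fun v hv => hdist _ z (by
      have := MultinomialMittagLeffler.abs_arg_expQ_le hρ_anti hρ_pos (fun j => (hw j).2)
        (by positivity : 0 < θ / ρ 0) (by linarith) hv
      rwa [hθφ] at this) hz1) (max p 2)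
  have hsum : ∑ i ∈ Finset.range (max p 2),
      MultinomialMittagLeffler.expansionCoeff ρ β (i + 1) w / z ^ (i + 1)
      = -(- (1 / z) * (1 / (Real.Gamma (β - ρ 0) : ℂ))
          - 1 / z ^ 2 * (1 / (Real.Gamma (β - 2 * ρ 0) : ℂ)
            - ∑ j : Fin n, (w j : ℂ) / (Real.Gamma (β - ρ 0 - ρ j.succ) : ℂ))
          - ∑ k ∈ Finset.Icc 3 p, MultinomialMittagLeffler.expansionCoeff ρ β k w / z ^ k) := by
    have hIcc : Finset.Icc 3 p = Finset.Ico 3 (max p 2 + 1) := by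
      ext k
      simp only [Finset.mem_Icc, Finset.mem_Ico]
      omega
    obtain ⟨q, hq⟩ : ∃ q, max p 2 = q + 2 := ⟨max p 2 - 2, by omega⟩
    rw [hIcc, Finset.sum_Ico_eq_sum_range, hq, Finset.sum_range_succ', Finset.sum_range_succ',
      show q + 2 + 1 - 3 = q by omega,
      ← MultinomialMittagLeffler.expansionCoeff_one hρ_anti hρ_pos hβ w,
      ← MultinomialMittagLeffler.expansionCoeff_two hρ_anti hρ_pos hβ w]
    have : ∀ i, MultinomialMittagLeffler.expansionCoeff ρ β (i + 1 + 1 + 1) w / z ^ (i + 1 + 1 + 1)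
        = MultinomialMittagLeffler.expansionCoeff ρ β (3 + i) w / z ^ (3 + i) := fun i => by
      rw [show i + 1 + 1 + 1 = 3 + i by ring]
    simp only [this, zero_add, Nat.reduceAdd, pow_one]
    ring
  rw [hsum, ← sub_eq_add_neg] at hbound
  refine hbound.trans ?_
  have hpow : (‖z‖ ^ (max p 2 + 1))⁻¹ ≤ (‖z‖ ^ (p + 1))⁻¹ :=
    inv_anti₀ (by positivity) (pow_le_pow_right₀ hz (by omega))
  exact mul_le_mul (le_max_left _ _) hpow (by positivity) (le_max_of_le_right zero_le_one)
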